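/- Let $X \subseteq \mathbb{P}^2_{\mathbb{C}}$ be a smooth real plane curve, that is, the zero locus of a homogeneous polynomial $F \in \mathbb{R}[x,y,z]$ that is irreducible in $\mathbb{C}[x,y,z]$, such that $X$ is not contained in a line and the gradient of $F$ vanishes at no complex point of $X$. Assume that $X$ has a (smooth) real point. Write $X_{\mathbb{R}} \subseteq \mathbb{P}^2_{\mathbb{R}}$ for the set of real points of $X$, and let $$\mathcal{N}(X) = \{\, \#(X\cap W)_{\mathbb{R}} : W \subseteq \mathbb{P}^2_{\mathbb{C}} \text{ a line defined by a real linear form that meets } X \text{ transversely at every complex intersection point} \,\}.$$ Then the maximum $\mathcal{N}(X)_{\max}$ of $\mathcal{N}(X)$ equals $2$ (the minimal possible value) if and only if $X_{\mathbb{R}}$ is a convex oval, meaning that there is a real line $L \subseteq \mathbb{P}^2_{\mathbb{R}}$ disjoint from $X_{\mathbb{R}}$ such that, in the affine plane $\mathbb{P}^2_{\mathbb{R}} \setminus L \cong \mathbb{R}^2$, the set $X_{\mathbb{R}}$ is a simple closed curve that is the boundary of its convex hull. -/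

import Mathlib

open scoped LinearAlgebra.Projectivization

/-- The complex projective plane. -/
abbrev ComplexPlane : Type := ℙ ℂ (Fin 3 → ℂ)

/-- The real projective plane. -/
abbrev RealPlane : Type := ℙ ℝ (Fin 3 → ℝ)

/-- Coordinatewise inclusion of real vectors into complex vectors. -/
def complexifyVec : (Fin 3 → ℝ) →ₛₗ[algebraMap ℝ ℂ] (Fin 3 → ℂ) where
  toFun v := fun i => (v i : ℂ)
  map_add' v w := by
    funext i
    simp
  map_smul' c v := by
    funext i
    simp

theorem complexifyVec_injective : Function.Injective complexifyVec := by
  intro v w h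
  funext i
  exact Complex.ofReal_injective (congrFun h i)

/-- The inclusion of the real projective plane into the complex one. -/
noncomputable def realToComplex : RealPlane → ComplexPlane :=
  Projectivization.map complexifyVec complexifyVec_injective

/-- The points of the complex projective plane at which a form vanishes. For a homogeneous
polynomial this does not depend on the chosen representative vector. -/
noncomputable def projZeroLocus (F : MvPolynomial (Fin 3) ℂ) : Set ComplexPlane :=
  {p | MvPolynomial.eval p.rep F = 0}

/-- The line in the complex projective plane with equation `a 0 * x + a 1 * y + a 2 * z = 0`. -/
noncomputable def projLine (a : Fin 3 → ℂ) : Set ComplexPlane :=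
  {p | ∑ i, a i * p.rep i = 0}

/-- A real plane curve: the zero locus in the complex projective plane of a real form which is
irreducible over the complex numbers (so the curve is irreducible and reduced), and which is
non-degenerate, i.e. not contained in any line. -/
structure RealPlaneCurve where
  form : MvPolynomial (Fin 3) ℝ
  degree : ℕ
  isHomogeneous : form.IsHomogeneous degree
  irreducible : Irreducible (MvPolynomial.map (algebraMap ℝ ℂ) form)
  nondegenerate : ∀ a : Fin 3 → ℂ, a ≠ 0 →
    ¬ projZeroLocus (MvPolynomial.map (algebraMap ℝ ℂ) form) ⊆ projLine a

namespace RealPlaneCurve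

/-- The defining form, with coefficients regarded as complex numbers. -/
noncomputable def complexForm (X : RealPlaneCurve) : MvPolynomial (Fin 3) ℂ :=
  MvPolynomial.map (algebraMap ℝ ℂ) X.form

/-- The set of complex points of the curve. -/
noncomputable def points (X : RealPlaneCurve) : Set ComplexPlane :=
  projZeroLocus X.complexForm

/-- The set of real points of the curve, as a subset of the real projective plane. -/
noncomputable def realPoints (X : RealPlaneCurve) : Set RealPlane :=
  realToComplex ⁻¹' X.points

/-- The gradient of the defining form at (a representative of) a point. Another representative
changes it by a nonzero factor. -/
noncomputable def gradient (X : RealPlaneCurve) (p : ComplexPlane) : Fin 3 → ℂ :=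
  fun i => MvPolynomial.eval p.rep (MvPolynomial.pderiv i X.complexForm)

/-- The point `p` is a smooth point of the curve. -/
def IsSmoothAt (X : RealPlaneCurve) (p : ComplexPlane) : Prop :=
  p ∈ X.points ∧ X.gradient p ≠ 0

/-- The curve is smooth: all its complex points are smooth points. -/
def IsSmooth (X : RealPlaneCurve) : Prop :=
  ∀ p ∈ X.points, X.IsSmoothAt p

/-- The line with coefficient vector `a` meets the curve transversely: at every complex
intersection point the curve is smooth and its tangent line, whose coefficient vector is the
gradient, differs from the given line. -/
def TransverseTo (X : RealPlaneCurve) (a : Fin 3 → ℂ) : Prop :=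
  ∀ p ∈ X.points ∩ projLine a, LinearIndependent ℂ ![X.gradient p, a]

/-- The set of possible numbers of real solutions: the numbers of real points in the intersections
of the curve with real lines that meet it transversely. -/
def possibleNumbers (X : RealPlaneCurve) : Set ℕ :=
  {n | ∃ a : Fin 3 → ℝ, a ≠ 0 ∧ X.TransverseTo (complexifyVec a) ∧
    (realToComplex ⁻¹' (X.points ∩ projLine (complexifyVec a))).encard = (n : ℕ∞)}

end RealPlaneCurve

/-- The standard affine chart of the real projective plane, sending `(x, y)` to `[x : y : 1]`. -/
noncomputable def affinePoint (q : ℝ × ℝ) : RealPlane :=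
  Projectivization.mk ℝ ![q.1, q.2, 1] (fun h => one_ne_zero (congrFun h 2))

/-- A subset of the real projective plane is a convex oval if, in the affine plane that is the
complement of some line, it is a simple closed curve that is the boundary of a convex region
(necessarily its convex hull). The complements of lines are the images of the standard affine chart
under projective transformations. -/
def IsConvexOval (S : Set RealPlane) : Prop :=
  ∃ (e : (Fin 3 → ℝ) ≃ₗ[ℝ] (Fin 3 → ℝ)) (γ : Circle → ℝ × ℝ),
    Continuous γ ∧ Function.Injective γ ∧
    frontier (convexHull ℝ (Set.range γ)) = Set.range γ ∧
    S = Projectivization.map e.toLinearMap e.injective '' (affinePoint '' Set.range γ)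

/-!
Write `F` for the real form defining the curve and identify real lines with parametrized lines
`u + T q` in `ℝ³`.

*General lines are transverse* (`RealPlaneCurve.exists_transverse`). If `F q ≠ 0`, then
`F (x + T q)` is irreducible in `ℂ[x][T]`, being the image of `F` under an automorphism, so it is separable
over `ℂ(x)`. Clearing denominators, `F (u + T q)` has no multiple root for `u` outside a proper
algebraic subset, and then the line through `u` and `q` is transverse to the curve.

*From the bound to the oval* (`RealPlaneCurve.isConvexOval_of_bounded`). If all transverse lines
have at most two real points, then no line carries four points at which `F` has alternating signs:
this would persist on nearby lines, some of them transverse, and give three zeros there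
(`RealPlaneCurve.noFourAlternations`). Rotating or displacing the tangent line at a real point
would produce such alternations unless the contact point is the only zero on it and `F` has one
sign along it; so pushing the tangent line to the correct side gives a line disjoint from the real
points (`IsOvalForm.exists_disjoint_line`). In the affine plane that is its complement, `F` has
one sign far away, say positive. The set `F ≤ 0` is then convex, because a positive value between
two negative ones would again give four alternating signs. Its frontier is the zero set, its
interior is the set `F < 0`, and the frontier of a bounded convex set with interior points is a
circle.

*From the oval to the bound* (`RealPlaneCurve.le_two_of_mem_possibleNumbers`,
`RealPlaneCurve.two_mem_possibleNumbers`). The curve contains no segment, so the middle one of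
three collinear points of the oval would lie between two interior points of the convex hull and
would not be on the frontier. A general line through an interior point is transverse and meets the
oval exactly twice.
-/

/-! ### Polynomials on parametrized lines -/

namespace MvPolynomial

section RestrictLine

variable {σ R : Type*} [CommRing R]

/-- The restriction `F (u + T q)` of a polynomial `F` to the parametrized line through `u` with
direction `q`, as a polynomial in the parameter `T`. -/
noncomputable def restrictLine (F : MvPolynomial σ R) (u q : σ → R) : Polynomial R :=
  aeval (fun i => Polynomial.C (u i) + Polynomial.X * Polynomial.C (q i)) F

theorem eval_restrictLine (F : MvPolynomial σ R) (u q : σ → R) (t : R) :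
    (F.restrictLine u q).eval t = eval (u + t • q) F := by
  induction F using MvPolynomial.induction_on with
  | C a => simp [restrictLine]
  | add p q hp hq => simpa [restrictLine] using congrArg₂ (· + ·) hp hq
  | mul_X p i hp =>
    simp only [restrictLine, map_mul, aeval_X, Polynomial.eval_mul] at hp ⊢
    rw [hp]
    simp [mul_comm t]

variable [Fintype σ]

/-- The derivative of `F` in the direction `q`. -/
noncomputable def dirDeriv (F : MvPolynomial σ R) (q : σ → R) : MvPolynomial σ R :=
  ∑ i, C (q i) * pderiv i F

theorem eval_dirDeriv (F : MvPolynomial σ R) (q v : σ → R) :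
    eval v (F.dirDeriv q) = ∑ i, q i * eval v (pderiv i F) := by
  simp [dirDeriv]

theorem derivative_restrictLine (F : MvPolynomial σ R) (u q : σ → R) :
    Polynomial.derivative (F.restrictLine u q) = (F.dirDeriv q).restrictLine u q := by
  classical
  induction F using MvPolynomial.induction_on with
  | C a => simp [restrictLine, dirDeriv]
  | add p r hp hr =>
    have : (p + r).dirDeriv q = p.dirDeriv q + r.dirDeriv q := by
      simp [dirDeriv, mul_add, Finset.sum_add_distrib]
    rw [this]
    simpa [restrictLine] using congrArg₂ (· + ·) hp hr
  | mul_X p i hp =>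
    have : (p * X i).dirDeriv q = X i * p.dirDeriv q + C (q i) * p := by
      simp only [dirDeriv, pderiv_mul, pderiv_X, mul_add, Finset.sum_add_distrib, Finset.mul_sum]
      congr 1
      · exact Finset.sum_congr rfl fun j _ => by ring
      · rw [Finset.sum_eq_single i]
        · simp
        · intro j _ hj
          simp [hj.symm]
        · simp
    rw [this]
    simp only [restrictLine, map_mul, map_add, aeval_X, Polynomial.derivative_mul] at hp ⊢
    rw [hp]
    simp only [Polynomial.derivative_C, Polynomial.derivative_X, aeval_C,
      Polynomial.algebraMap_eq]
    ring

theorem eval_derivative_restrictLine (F : MvPolynomial σ R) (u q : σ → R) (t : R) :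
    (Polynomial.derivative (F.restrictLine u q)).eval t
      = ∑ i, q i * eval (u + t • q) (pderiv i F) := by
  rw [derivative_restrictLine, eval_restrictLine, eval_dirDeriv]

end RestrictLine

theorem IsHomogeneous.eval_smul {σ R : Type*} [CommRing R] {F : MvPolynomial σ R} {n : ℕ}
    (hF : F.IsHomogeneous n) (c : R) (v : σ → R) : eval (c • v) F = c ^ n * eval v F := by
  rw [eval_eq, eval_eq, Finset.mul_sum]
  refine Finset.sum_congr rfl fun m hm => ?_
  have hd : ∑ i ∈ m.support, m i = n := by
    have := hF (mem_support_iff.1 hm)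
    simpa [Finsupp.weight_apply, Finsupp.sum] using this
  simp only [Pi.smul_apply, smul_eq_mul, mul_pow, Finset.prod_mul_distrib,
    Finset.prod_pow_eq_pow_sum, hd]
  ring

theorem IsHomogeneous.sum_mul_eval_pderiv {σ R : Type*} [Fintype σ] [CommRing R]
    {F : MvPolynomial σ R} {n : ℕ} (hF : F.IsHomogeneous n) (v : σ → R) :
    ∑ i, v i * eval v (pderiv i F) = n * eval v F := by
  simpa using congrArg (eval v) hF.sum_X_mul_pderiv

/-! ### Generic lines in a given direction -/

section Generic

variable {σ K : Type*} [Field K]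

/-- The substitution `x ↦ x + T q` in `K[x][T]`. -/
noncomputable def shiftHom (q : σ → K) :
    Polynomial (MvPolynomial σ K) →+* Polynomial (MvPolynomial σ K) :=
  Polynomial.eval₂RingHom
    (eval₂Hom (Polynomial.C.comp C)
      fun i => Polynomial.C (X i) + Polynomial.X * Polynomial.C (C (q i))) Polynomial.X

theorem shiftHom_comp_neg (q : σ → K) : (shiftHom q).comp (shiftHom (-q)) = RingHom.id _ := by
  refine Polynomial.ringHom_ext' (MvPolynomial.ringHom_ext' ?_ ?_) ?_
  · ext a; simp [shiftHom]
  · intro i; simp [shiftHom]; ring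
  · simp [shiftHom]

/-- The generic line in direction `q`: for an irreducible form `F` with `F q ≠ 0`, the polynomial
`F (x + T q)` in `T` is irreducible over `K[x]`, hence separable over `K(x)`. Clearing denominators,
`F (u + T q)` has no multiple root as soon as a certain nonzero polynomial does not vanish at
`u`. -/
theorem exists_ne_zero_of_common_root [CharZero K] [Fintype σ] {F : MvPolynomial σ K} {d : ℕ}
    (hF : F.IsHomogeneous d) (hirr : Irreducible F) {q : σ → K} (hq : eval q F ≠ 0) :
    ∃ D : MvPolynomial σ K, D ≠ 0 ∧ ∀ (u : σ → K) (t : K), eval (u + t • q) F = 0 →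
      ∑ i, q i * eval (u + t • q) (pderiv i F) = 0 → eval u D = 0 := by
  classical
  let A := MvPolynomial σ K
  let : NormalizedGCDMonoid A := Classical.choice inferInstance
  let e : Polynomial A ≃+* Polynomial A :=
    RingEquiv.ofRingHom (shiftHom q) (shiftHom (-q)) (shiftHom_comp_neg q)
      (by simpa using shiftHom_comp_neg (-q))
  let G : Polynomial A := shiftHom q (Polynomial.C F)
  have hG : ∀ u, G.map (eval u) = F.restrictLine u q := by
    intro u
    have : ((Polynomial.mapRingHom (eval u)).comp ((shiftHom q).comp Polynomial.C))
        = (aeval (fun i => Polynomial.C (u i) + Polynomial.X * Polynomial.C (q i)) :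
            MvPolynomial σ K →ₐ[K] Polynomial K).toRingHom := by
      refine MvPolynomial.ringHom_ext ?_ ?_
      · intro r; simp [shiftHom, Polynomial.algebraMap_eq]
      · intro i; simp [shiftHom]
    exact congrArg (fun φ : MvPolynomial σ K →+* Polynomial K => φ F) this
  have hGirr : Irreducible G := by
    have h1 : Irreducible (Polynomial.C F) := (Polynomial.prime_C_iff.2 hirr.prime).irreducible
    exact (MulEquiv.irreducible_iff e.toMulEquiv).2 h1
  have hd : d ≠ 0 := by
    rintro rfl
    rw [← totalDegree_zero_iff_isHomogeneous, totalDegree_eq_zero_iff_eq_C] at hF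
    rw [hF] at hirr hq
    refine hirr.not_isUnit (IsUnit.map C (isUnit_iff_ne_zero.2 ?_))
    simpa using hq
  have hdeg : G.natDegree ≠ 0 := by
    intro h0
    obtain ⟨c, hc⟩ := Polynomial.natDegree_eq_zero.1 h0
    have h1 := hG 0
    rw [← hc, Polynomial.map_C] at h1
    have h2 : ∀ t : K, eval 0 c = t ^ d * eval q F := by
      intro t
      have := congrArg (Polynomial.eval t) h1
      rw [eval_restrictLine, zero_add, hF.eval_smul] at this
      simpa using this
    have h3 := (h2 0).symm.trans (h2 1)
    simp [hd] at h3
    exact hq h3.symm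
  let L := FractionRing A
  have hsep : (G.map (algebraMap A L)).Separable :=
    (((hGirr.isPrimitive hdeg).irreducible_iff_irreducible_map_fraction_map (K := L)).1
      hGirr).separable
  obtain ⟨a, b, hab⟩ := hsep
  obtain ⟨r, hr, har⟩ := IsLocalization.integerNormalization_spec (nonZeroDivisors A) a
  obtain ⟨s, hs, hbs⟩ := IsLocalization.integerNormalization_spec (nonZeroDivisors A) b
  set a' := IsLocalization.integerNormalization (nonZeroDivisors A) a
  set b' := IsLocalization.integerNormalization (nonZeroDivisors A) b
  have key : Polynomial.C s * a' * G + Polynomial.C r * b' * Polynomial.derivative G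
      = Polynomial.C (r * s) := by
    apply Polynomial.map_injective (algebraMap A L) (IsFractionRing.injective A L)
    have h1 : ∀ (c : A) (p : Polynomial L), c • p = Polynomial.C (algebraMap A L c) * p := by
      intro c p
      rw [← Polynomial.smul_eq_C_mul, algebraMap_smul]
    simp only [Polynomial.map_add, Polynomial.map_mul, Polynomial.map_C, har, hbs, h1, map_mul,
      ← Polynomial.derivative_map]
    linear_combination (Polynomial.C (algebraMap A L r) * Polynomial.C (algebraMap A L s)) * hab
  refine ⟨r * s, mul_ne_zero (nonZeroDivisors.ne_zero hr) (nonZeroDivisors.ne_zero hs),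
    fun u t h1 h2 => ?_⟩
  have h3 := congrArg (fun p => Polynomial.eval t (Polynomial.map (eval u) p)) key
  simp only [Polynomial.map_add, Polynomial.map_mul, Polynomial.map_C, ← Polynomial.derivative_map,
    hG, Polynomial.eval_add, Polynomial.eval_mul, eval_restrictLine, eval_derivative_restrictLine,
    h1, h2, Polynomial.eval_C] at h3
  simpa using h3.symm

end Generic

/-- A nonzero complex polynomial does not vanish at all real points near a given real point. -/
theorem exists_real_eval_ne_zero {ι : Type*} [Finite ι] {D : MvPolynomial ι ℂ} (hD : D ≠ 0)
    {U : Set (ι → ℝ)} (hU : IsOpen U) {u : ι → ℝ} (hu : u ∈ U) :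
    ∃ v ∈ U, eval (fun i => (v i : ℂ)) D ≠ 0 := by
  have := Fintype.ofFinite ι
  by_contra! h
  obtain ⟨ε, hε, hball⟩ := Metric.isOpen_iff.1 hU u hu
  refine hD (funext_set (fun i => ((↑) : ℝ → ℂ) '' Metric.ball (u i) ε) (fun i => ?_) ?_)
  · refine Set.Infinite.image Complex.ofReal_injective.injOn ?_
    rw [Real.ball_eq_Ioo]
    exact Set.Ioo_infinite (by linarith)
  · intro x hx
    choose v hv hvx using fun i => hx i (Set.mem_univ i)
    have : (fun i => (v i : ℂ)) = x := _root_.funext hvx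
    rw [← this, map_zero]
    exact h v (hball ((dist_pi_lt_iff hε).2 hv))

/-! ### Forms vanishing on a line -/

open Matrix in
/-- A form in three variables that vanishes on the line through `v` and `w` is divisible by the
linear form `v ⨯₃ w` of that line. -/
theorem cross_dvd_of_isHomogeneous {K : Type*} [Field K] [Infinite K] {F : MvPolynomial (Fin 3) K}
    {d : ℕ} (hF : F.IsHomogeneous d) {v w : Fin 3 → K} (ha : (v ⨯₃ w) ⬝ᵥ (v ⨯₃ w) ≠ 0)
    (h : ∀ t : K, eval (v + t • w) F = 0) : (∑ i, C ((v ⨯₃ w) i) * X i) ∣ F := by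
  set a := v ⨯₃ w with ha'
  set A : MvPolynomial (Fin 3) K := ∑ i, C (a i) * X i with hA
  -- `F` vanishes on the whole plane spanned by `v` and `w`, including the multiples of `w`.
  have hplane : ∀ s t : K, eval (s • v + t • w) F = 0 := by
    have h0 : ∀ s t : K, s ≠ 0 → eval (s • v + t • w) F = 0 := by
      intro s t hs
      have : s • v + t • w = s • (v + (s⁻¹ * t) • w) := by
        rw [smul_add, smul_smul, mul_inv_cancel_left₀ hs]
      rw [this, hF.eval_smul, h, mul_zero]
    intro s t
    have h1 : F.restrictLine (t • w) v = 0 := by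
      refine Polynomial.eq_zero_of_infinite_isRoot _ (Set.Infinite.mono (s := {0}ᶜ) ?_ ?_)
      · intro s hs
        rw [Set.mem_ofPred, Polynomial.IsRoot.def, eval_restrictLine, add_comm]
        exact h0 s t hs
      · exact (Set.finite_singleton 0).infinite_compl
    rw [add_comm, ← eval_restrictLine, h1, Polynomial.eval_zero]
  -- Expand a vector in the basis `v`, `w`, `a`: the coefficient of `a` is the linear form `A`.
  let α : MvPolynomial (Fin 3) K := ∑ i, C ((w ⨯₃ a) i) * X i
  let β : MvPolynomial (Fin 3) K := ∑ i, C ((a ⨯₃ v) i) * X i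
  have hexp : ∀ i, C (a ⬝ᵥ a) * X i = α * C (v i) + β * C (w i) + A * C (a i) := by
    intro i
    fin_cases i <;>
    · simp only [α, β, hA, ha', cross_apply, Fin.sum_univ_three, dotProduct]
      simp
      ring
  have hzero : aeval (fun i => α * C (v i) + β * C (w i)) F = 0 := by
    refine funext fun x => ?_
    have := hplane (eval x α) (eval x β)
    rw [map_zero, map_aeval]
    refine Eq.trans ?_ this
    simp only [coe_eval₂Hom, algebraMap_eq]
    have hc : (eval x).comp C = RingHom.id K := by ext; simp
    rw [hc]
    change _ = eval₂ (RingHom.id K) _ F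
    congr 1
    ext i
    simp
  have hscale : aeval (fun i => C (a ⬝ᵥ a) * X i) F = C ((a ⬝ᵥ a) ^ d) * F := by
    refine funext fun x => ?_
    rw [map_aeval, map_mul, eval_C, ← hF.eval_smul]
    simp only [coe_eval₂Hom, algebraMap_eq]
    have hc : (eval x).comp C = RingHom.id K := by ext; simp
    rw [hc]
    change _ = eval₂ (RingHom.id K) _ F
    congr 1
    ext i
    simp
  have hmod : A ∣ aeval (fun i => C (a ⬝ᵥ a) * X i) F
      - aeval (fun i => α * C (v i) + β * C (w i)) F := by
    rw [← Ideal.mem_span_singleton, ← Ideal.Quotient.eq, map_aeval, map_aeval]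
    congr 2
    ext i
    rw [hexp, Ideal.Quotient.eq, Ideal.mem_span_singleton]
    exact ⟨C (a i), by ring⟩
  rw [hzero, sub_zero, hscale] at hmod
  refine (IsUnit.dvd_mul_left ?_).1 hmod
  exact (isUnit_iff_ne_zero.2 (pow_ne_zero d ha)).map C

end MvPolynomial

/-! ### Real points and real lines of a plane curve -/

open MvPolynomial Matrix Filter Topology

@[simp] theorem complexifyVec_apply (v : Fin 3 → ℝ) (i : Fin 3) : complexifyVec v i = (v i : ℂ) :=
  rfl

theorem complexifyVec_ne_zero {v : Fin 3 → ℝ} (hv : v ≠ 0) : complexifyVec v ≠ 0 := fun h =>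
  hv (complexifyVec_injective (h.trans (map_zero complexifyVec).symm))

theorem eval_complexifyVec (F : MvPolynomial (Fin 3) ℝ) (v : Fin 3 → ℝ) :
    eval (complexifyVec v) (map (algebraMap ℝ ℂ) F) = (eval v F : ℂ) := by
  rw [eval_map]
  exact (eval₂_comp_left (algebraMap ℝ ℂ) (RingHom.id ℝ) v F).symm

theorem mk_mem_projLine {a v : Fin 3 → ℂ} (hv : v ≠ 0) :
    Projectivization.mk ℂ v hv ∈ projLine a ↔ a ⬝ᵥ v = 0 := by
  obtain ⟨c, hc⟩ := Projectivization.exists_smul_eq_mk_rep ℂ v hv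
  change a ⬝ᵥ _ = 0 ↔ _
  rw [← hc, Units.smul_def, dotProduct_smul, smul_eq_zero]
  simp

theorem mk_mem_realLine {a v : Fin 3 → ℝ} (hv : v ≠ 0) :
    realToComplex (Projectivization.mk ℝ v hv) ∈ projLine (complexifyVec a) ↔ a ⬝ᵥ v = 0 := by
  rw [realToComplex, Projectivization.map_mk, mk_mem_projLine]
  simp only [dotProduct, complexifyVec_apply]
  norm_cast

/-- The expansion of `p` in the frame `u`, `q`, `u ⨯₃ q`, freed of denominators. -/
theorem dotProduct_cross_self_expansion {R : Type*} [CommRing R] (u q p : Fin 3 → R) :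
    ((u ⨯₃ q) ⬝ᵥ (u ⨯₃ q)) • p = (p ⬝ᵥ (q ⨯₃ (u ⨯₃ q))) • u + (p ⬝ᵥ ((u ⨯₃ q) ⨯₃ u)) • q
      + ((u ⨯₃ q) ⬝ᵥ p) • (u ⨯₃ q) := by
  ext i
  fin_cases i <;>
  · simp [cross_apply, Fin.sum_univ_three, dotProduct]
    ring

namespace RealPlaneCurve

variable (X : RealPlaneCurve)

theorem isHomogeneous_complexForm : X.complexForm.IsHomogeneous X.degree :=
  X.isHomogeneous.map _

theorem mk_mem_points {v : Fin 3 → ℂ} (hv : v ≠ 0) :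
    Projectivization.mk ℂ v hv ∈ X.points ↔ eval v X.complexForm = 0 := by
  obtain ⟨c, hc⟩ := Projectivization.exists_smul_eq_mk_rep ℂ v hv
  change eval _ X.complexForm = 0 ↔ _
  rw [← hc, Units.smul_def, X.isHomogeneous_complexForm.eval_smul]
  simp

theorem mk_mem_realPoints {v : Fin 3 → ℝ} (hv : v ≠ 0) :
    Projectivization.mk ℝ v hv ∈ X.realPoints ↔ eval v X.form = 0 := by
  rw [realPoints, Set.mem_preimage, realToComplex, Projectivization.map_mk, mk_mem_points,
    complexForm, eval_complexifyVec, Complex.ofReal_eq_zero]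

theorem degree_ne_zero : X.degree ≠ 0 := by
  intro h
  have hF := X.isHomogeneous_complexForm
  rw [h, ← totalDegree_zero_iff_isHomogeneous, totalDegree_eq_zero_iff_eq_C] at hF
  have hirr : Irreducible X.complexForm := X.irreducible
  rw [hF] at hirr
  refine hirr.not_isUnit (IsUnit.map C (isUnit_iff_ne_zero.2 fun h0 => ?_))
  rw [h0, C_0] at hirr
  exact hirr.ne_zero rfl

variable {X}

/-- The real gradient does not vanish at real points of a smooth curve. -/
theorem IsSmooth.exists_pderiv_ne_zero (hX : X.IsSmooth) {v : Fin 3 → ℝ} (hv : v ≠ 0)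
    (h : eval v X.form = 0) : ∃ i, eval v (pderiv i X.form) ≠ 0 := by
  have h1 : realToComplex (Projectivization.mk ℝ v hv) ∈ X.points := (X.mk_mem_realPoints hv).2 h
  have h2 := (hX _ h1).2
  by_contra! h3
  refine h2 (funext fun i => ?_)
  rw [realToComplex, Projectivization.map_mk]
  obtain ⟨c, hc⟩ := Projectivization.exists_smul_eq_mk_rep ℂ (complexifyVec v)
    (complexifyVec_ne_zero hv)
  have hhom : (pderiv i X.complexForm).IsHomogeneous (X.degree - 1) :=
    X.isHomogeneous_complexForm.pderiv
  rw [gradient, ← hc, Units.smul_def, hhom.eval_smul, complexForm, pderiv_map, eval_complexifyVec,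
    h3 i]
  simp

/-- A real line is not contained in the curve: the form would be divisible by its equation, hence
proportional to it. -/
theorem restrictLine_ne_zero {v w : Fin 3 → ℝ} (hvw : v ⨯₃ w ≠ 0) :
    X.form.restrictLine v w ≠ 0 := by
  intro h
  have ha : (v ⨯₃ w) ⬝ᵥ (v ⨯₃ w) ≠ 0 := fun h0 => hvw (dotProduct_self_eq_zero.1 h0)
  have hdvd := cross_dvd_of_isHomogeneous X.isHomogeneous ha
    (fun t => by rw [← eval_restrictLine, h, Polynomial.eval_zero])
  obtain ⟨B, hB⟩ := map_dvd (MvPolynomial.map (algebraMap ℝ ℂ)) hdvd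
  rcases X.irreducible.isUnit_or_isUnit hB with hu | hu
  · have := hu.map (eval (0 : Fin 3 → ℂ))
    simp at this
  · refine X.nondegenerate _ (complexifyVec_ne_zero hvw) fun p hp => ?_
    change eval p.rep _ = 0 at hp
    rw [hB, map_mul] at hp
    rcases mul_eq_zero.1 hp with h1 | h1
    · simpa [projLine] using h1
    · exact absurd h1 (hu.map (eval p.rep)).ne_zero

theorem finite_roots {u q : Fin 3 → ℝ} (huq : u ⨯₃ q ≠ 0) :
    {t : ℝ | eval (u + t • q) X.form = 0}.Finite := by
  refine (Polynomial.finite_setOfPred_isRoot (restrictLine_ne_zero (X := X) huq)).subset ?_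
  intro t ht
  rw [Set.mem_ofPred, Polynomial.IsRoot.def, eval_restrictLine]
  exact ht

/-! ### Transverse lines -/

/-- The real line through `u` and `q` is transverse to the curve when `q` does not lie on the
curve and `F (u + T q)` has no multiple complex root. -/
theorem transverseTo_cross {u q : Fin 3 → ℝ} (huq : u ⨯₃ q ≠ 0) (hq : eval q X.form ≠ 0)
    (h : ∀ t : ℂ, eval (complexifyVec u + t • complexifyVec q) X.complexForm = 0 →
      ∑ i, complexifyVec q i * eval (complexifyVec u + t • complexifyVec q)
        (pderiv i X.complexForm) ≠ 0) :
    X.TransverseTo (complexifyVec (u ⨯₃ q)) := by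
  have hcross : complexifyVec (u ⨯₃ q) = complexifyVec u ⨯₃ complexifyVec q := by
    ext i
    fin_cases i <;> simp [cross_apply]
  have ha : (u ⨯₃ q) ⬝ᵥ (u ⨯₃ q) ≠ 0 := fun h0 => huq (dotProduct_self_eq_zero.1 h0)
  have haC : (complexifyVec u ⨯₃ complexifyVec q) ⬝ᵥ (complexifyVec u ⨯₃ complexifyVec q) ≠ 0 := by
    rw [← hcross]
    simp only [dotProduct, complexifyVec_apply]
    exact_mod_cast ha
  have hqa : complexifyVec q ⬝ᵥ complexifyVec (u ⨯₃ q) = 0 := by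
    rw [hcross, dot_cross_self]
  rintro p ⟨hp, hpa⟩
  have hrep := p.rep_nonzero
  change eval p.rep X.complexForm = 0 at hp
  change complexifyVec (u ⨯₃ q) ⬝ᵥ p.rep = 0 at hpa
  have hexp := dotProduct_cross_self_expansion (complexifyVec u) (complexifyVec q) p.rep
  rw [hcross] at hpa
  rw [hpa, zero_smul, add_zero] at hexp
  generalize (complexifyVec u ⨯₃ complexifyVec q) ⬝ᵥ (complexifyVec u ⨯₃ complexifyVec q) = c
    at hexp haC
  generalize p.rep ⬝ᵥ (complexifyVec q ⨯₃ (complexifyVec u ⨯₃ complexifyVec q)) = s at hexp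
  generalize p.rep ⬝ᵥ ((complexifyVec u ⨯₃ complexifyVec q) ⨯₃ complexifyVec u) = t at hexp
  have hp' : eval (c • p.rep) X.complexForm = 0 := by
    rw [X.isHomogeneous_complexForm.eval_smul, hp, mul_zero]
  have hs : s ≠ 0 := by
    rintro rfl
    rw [hexp, zero_smul, zero_add, X.isHomogeneous_complexForm.eval_smul, complexForm,
      eval_complexifyVec, mul_eq_zero, Complex.ofReal_eq_zero, or_iff_left hq] at hp'
    rw [eq_zero_of_pow_eq_zero hp', zero_smul, zero_smul, add_zero] at hexp
    exact (smul_ne_zero haC hrep) hexp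
  have hpt : p.rep = (c⁻¹ * s) • (complexifyVec u + (s⁻¹ * t) • complexifyVec q) := by
    rw [← inv_smul_smul₀ haC p.rep, hexp, smul_add, smul_add, smul_smul, smul_smul, smul_smul,
      mul_assoc, mul_inv_cancel_left₀ hs]
  have hcs : c⁻¹ * s ≠ 0 := mul_ne_zero (inv_ne_zero haC) hs
  rw [hpt, X.isHomogeneous_complexForm.eval_smul, mul_eq_zero,
    or_iff_right (pow_ne_zero _ hcs)] at hp
  have h1 := h _ hp
  have hgrad : complexifyVec q ⬝ᵥ X.gradient p ≠ 0 := by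
    have : complexifyVec q ⬝ᵥ X.gradient p = (c⁻¹ * s) ^ (X.degree - 1) *
        ∑ i, complexifyVec q i * eval (complexifyVec u + (s⁻¹ * t) • complexifyVec q)
        (pderiv i X.complexForm) := by
      rw [Finset.mul_sum]
      refine Finset.sum_congr rfl fun i _ => ?_
      have hhom : (pderiv i X.complexForm).IsHomogeneous (X.degree - 1) :=
        X.isHomogeneous_complexForm.pderiv
      rw [gradient, hpt, hhom.eval_smul]
      ring
    rw [this]
    exact mul_ne_zero (pow_ne_zero _ hcs) h1
  rw [LinearIndependent.pair_iff]
  intro x y hxy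
  have h2 := congrArg (fun z => complexifyVec q ⬝ᵥ z) hxy
  simp only [dotProduct_add, dotProduct_smul, hqa, dotProduct_zero, smul_eq_mul] at h2
  rw [mul_zero, add_zero, mul_eq_zero, or_iff_left hgrad] at h2
  refine ⟨h2, ?_⟩
  rw [h2, zero_smul, zero_add, smul_eq_zero] at hxy
  exact hxy.resolve_right (complexifyVec_ne_zero huq)

/-- The real points of the curve on the line through `u` and `q`, where `q` is not on the curve,
correspond to the real roots of `F (u + T q)`. -/
theorem encard_inter_cross {u q : Fin 3 → ℝ} (huq : u ⨯₃ q ≠ 0) (hq : eval q X.form ≠ 0) :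
    (realToComplex ⁻¹' (X.points ∩ projLine (complexifyVec (u ⨯₃ q)))).encard
      = {t : ℝ | eval (u + t • q) X.form = 0}.encard := by
  have ha : (u ⨯₃ q) ⬝ᵥ (u ⨯₃ q) ≠ 0 := fun h0 => huq (dotProduct_self_eq_zero.1 h0)
  have hne : ∀ t : ℝ, u + t • q ≠ 0 := by
    intro t h0
    apply huq
    rw [eq_neg_of_add_eq_zero_left h0]
    simp
  have hinj : Function.Injective fun t : ℝ => Projectivization.mk ℝ (u + t • q) (hne t) := by
    intro t t' htt
    obtain ⟨c, hc⟩ := (Projectivization.mk_eq_mk_iff' ℝ _ _ _ _).1 htt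
    have h1 : (c - 1) • (u ⨯₃ q) = 0 := by
      have := congrArg (fun z => z ⨯₃ q) hc
      simp only [map_add, map_smul, LinearMap.add_apply, LinearMap.smul_apply, cross_self,
        smul_zero, add_zero] at this
      rw [sub_smul, this, one_smul, sub_self]
    have hc1 : c = 1 := sub_eq_zero.1 ((smul_eq_zero.1 h1).resolve_right huq)
    rw [hc1, one_smul, add_right_inj] at hc
    by_contra hne'
    have : (t' - t) • q = 0 := by rw [sub_smul, hc, sub_self]
    rcases smul_eq_zero.1 this with h2 | h2
    · exact hne' (sub_eq_zero.1 h2).symm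
    · simp [h2] at huq
  rw [← hinj.encard_image]
  congr 1
  ext p
  induction p using Projectivization.ind with | h v hv =>
  rw [Set.mem_preimage, Set.mem_inter_iff, mk_mem_realLine, ← Set.mem_preimage,
    ← RealPlaneCurve.realPoints, mk_mem_realPoints]
  constructor
  · rintro ⟨h1, h2⟩
    have hexp := dotProduct_cross_self_expansion u q v
    rw [h2, zero_smul, add_zero] at hexp
    generalize (u ⨯₃ q) ⬝ᵥ (u ⨯₃ q) = c at hexp ha
    generalize v ⬝ᵥ (q ⨯₃ (u ⨯₃ q)) = s at hexp
    generalize v ⬝ᵥ ((u ⨯₃ q) ⨯₃ u) = t at hexp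
    have h1' : eval (c • v) X.form = 0 := by rw [X.isHomogeneous.eval_smul, h1, mul_zero]
    have hs : s ≠ 0 := by
      rintro rfl
      rw [hexp, zero_smul, zero_add, X.isHomogeneous.eval_smul, mul_eq_zero,
        or_iff_left hq] at h1'
      rw [eq_zero_of_pow_eq_zero h1', zero_smul, zero_smul, add_zero] at hexp
      exact (smul_ne_zero ha hv) hexp
    have hpt : u + (s⁻¹ * t) • q = (s⁻¹ * c) • v := by
      rw [mul_smul s⁻¹ c, hexp, smul_add, smul_smul, smul_smul, inv_mul_cancel₀ hs, one_smul]
    refine ⟨s⁻¹ * t, ?_, ?_⟩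
    · rw [Set.mem_ofPred, hpt, X.isHomogeneous.eval_smul, h1, mul_zero]
    · exact (Projectivization.mk_eq_mk_iff' ℝ _ _ _ _).2 ⟨_, hpt.symm⟩
  · rintro ⟨t, ht, htp⟩
    obtain ⟨c, hc⟩ := (Projectivization.mk_eq_mk_iff' ℝ _ _ _ _).1 htp
    have hc0 : c ≠ 0 := by
      rintro rfl
      exact hne t (by rw [← hc, zero_smul])
    have hv' : v = c⁻¹ • (u + t • q) := by rw [← hc, inv_smul_smul₀ hc0]
    rw [hv', X.isHomogeneous.eval_smul]
    refine ⟨by rw [ht, mul_zero], ?_⟩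
    rw [dotProduct_smul, dotProduct_add, dotProduct_smul, dotProduct_comm, dot_self_cross,
      dotProduct_comm, dot_cross_self]
    simp

/-- Transverse lines are dense: for `q` off the curve, the line through `q` and a general real
point `u` is transverse. -/
theorem exists_transverse {q : Fin 3 → ℝ} (hq : eval q X.form ≠ 0)
    {U : Set (Fin 3 → ℝ)} (hU : IsOpen U) (hne : U.Nonempty) :
    ∃ u ∈ U, u ⨯₃ q ≠ 0 ∧ X.TransverseTo (complexifyVec (u ⨯₃ q)) := by
  have hqC : eval (complexifyVec q) X.complexForm ≠ 0 := by
    rw [complexForm, eval_complexifyVec]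
    exact_mod_cast hq
  obtain ⟨D, hD, hDq⟩ := exists_ne_zero_of_common_root X.isHomogeneous_complexForm X.irreducible hqC
  -- Multiplying `D` by a coordinate of `u ⨯₃ q` also makes `u` and `q` independent.
  have hq0 : q ≠ 0 := by
    rintro rfl
    have := X.isHomogeneous.eval_smul 0 0
    rw [zero_smul, zero_pow X.degree_ne_zero, zero_mul] at this
    exact hq this
  obtain ⟨E, hE, hEq⟩ : ∃ E : MvPolynomial (Fin 3) ℂ, E ≠ 0 ∧
      ∀ u : Fin 3 → ℝ, u ⨯₃ q = 0 → eval (complexifyVec u) E = 0 := by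
    obtain ⟨u₀, i, hi⟩ : ∃ (u₀ : Fin 3 → ℝ) (i : Fin 3), (u₀ ⨯₃ q) i ≠ 0 := by
      by_contra! h
      apply hq0
      have h1 := h ![1, 0, 0]
      have h2 := h ![0, 1, 0]
      simp only [cross_apply, Fin.forall_fin_succ] at h1 h2
      simp at h1 h2
      ext j
      fin_cases j <;> simp_all
    have hlin : ∀ x : Fin 3 → ℂ,
        eval x (∑ j, C (complexifyVec (Pi.single j 1 ⨯₃ q) i) * MvPolynomial.X j :
            MvPolynomial (Fin 3) ℂ)
          = ∑ j, complexifyVec (Pi.single j 1 ⨯₃ q) i * x j := by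
      intro x; simp
    have hval : ∀ u : Fin 3 → ℝ,
        ∑ j, complexifyVec (Pi.single j 1 ⨯₃ q) i * complexifyVec u j
          = complexifyVec (u ⨯₃ q) i := by
      intro u
      have : (u ⨯₃ q) i = ∑ j, (Pi.single j 1 ⨯₃ q) i * u j := by
        fin_cases i <;> simp [cross_apply, Fin.sum_univ_three] <;> ring
      simp only [complexifyVec_apply, this]
      push_cast
      rfl
    refine ⟨∑ j, C (complexifyVec (Pi.single j 1 ⨯₃ q) i) * MvPolynomial.X j, fun h0 => ?_,
      fun u hu => ?_⟩
    · have := hlin (complexifyVec u₀)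
      rw [h0, map_zero, hval] at this
      exact hi (Complex.ofReal_eq_zero.1 this.symm)
    · rw [hlin, hval, hu]
      simp
  obtain ⟨u₁, hu₁⟩ := hne
  obtain ⟨u, huU, hu⟩ := exists_real_eval_ne_zero (mul_ne_zero hD hE) hU hu₁
  change eval (complexifyVec u) _ ≠ 0 at hu
  rw [map_mul, mul_ne_zero_iff] at hu
  have huq : u ⨯₃ q ≠ 0 := fun h => hu.2 (hEq u h)
  exact ⟨u, huU, huq, transverseTo_cross huq hq fun t h1 h2 => hu.1 (hDq _ t h1 h2)⟩

end RealPlaneCurve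

/-! ### Alternating signs on lines -/

/-- No parametrized real line carries four successive points at which `F` has the signs `+ - + -`.
The pattern `- + - +` is the same one for the reversed parametrization. -/
def NoFourAlternations (F : MvPolynomial (Fin 3) ℝ) : Prop :=
  ∀ (u w : Fin 3 → ℝ) (t₁ t₂ t₃ t₄ : ℝ), t₁ < t₂ → t₂ < t₃ → t₃ < t₄ →
    0 < eval (u + t₁ • w) F → eval (u + t₂ • w) F < 0 → 0 < eval (u + t₃ • w) F →
    ¬ eval (u + t₄ • w) F < 0

namespace NoFourAlternations

variable {F : MvPolynomial (Fin 3) ℝ}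

theorem opposite (h : NoFourAlternations F) {u w : Fin 3 → ℝ} {t₁ t₂ t₃ t₄ : ℝ} (h₁₂ : t₁ < t₂)
    (h₂₃ : t₂ < t₃) (h₃₄ : t₃ < t₄) (h₁ : eval (u + t₁ • w) F < 0) (h₂ : 0 < eval (u + t₂ • w) F)
    (h₃ : eval (u + t₃ • w) F < 0) : ¬ 0 < eval (u + t₄ • w) F := by
  intro h₄
  have hneg : ∀ t : ℝ, u + (-t) • (-w) = u + t • w := fun t => by rw [neg_smul_neg]
  refine h u (-w) (-t₄) (-t₃) (-t₂) (-t₁) (by linarith) (by linarith) (by linarith) ?_ ?_ ?_ ?_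
  all_goals rwa [hneg]

theorem neg (h : NoFourAlternations F) : NoFourAlternations (-F) := by
  intro u w t₁ t₂ t₃ t₄ h₁₂ h₂₃ h₃₄ h₁ h₂ h₃ h₄
  simp only [map_neg, Left.neg_pos_iff, Left.neg_neg_iff] at h₁ h₂ h₃ h₄
  exact h.opposite h₁₂ h₂₃ h₃₄ h₁ h₂ h₃ h₄

end NoFourAlternations

theorem exists_root_of_sign_change {F : MvPolynomial (Fin 3) ℝ} {u w : Fin 3 → ℝ} {a b : ℝ}
    (hab : a < b) (h : eval (u + a • w) F * eval (u + b • w) F < 0) :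
    ∃ t, a < t ∧ t < b ∧ eval (u + t • w) F = 0 := by
  have hc : ContinuousOn (fun t : ℝ => eval (u + t • w) F) (Set.Icc a b) :=
    ((MvPolynomial.continuous_eval F).comp (by fun_prop)).continuousOn
  rcases mul_neg_iff.1 h with ⟨h1, h2⟩ | ⟨h1, h2⟩
  · obtain ⟨t, ht, h0⟩ := intermediate_value_Ioo' hab.le hc ⟨h2, h1⟩
    exact ⟨t, ht.1, ht.2, h0⟩
  · obtain ⟨t, ht, h0⟩ := intermediate_value_Ioo hab.le hc ⟨h1, h2⟩
    exact ⟨t, ht.1, ht.2, h0⟩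

theorem exists_eval_ne_zero_of_restrictLine_ne_zero {F : MvPolynomial (Fin 3) ℝ}
    {v w : Fin 3 → ℝ} (h : F.restrictLine v w ≠ 0) {a b : ℝ} (hab : a < b) :
    ∃ x, a < x ∧ x < b ∧ eval (v + x • w) F ≠ 0 := by
  by_contra! h0
  refine h (Polynomial.eq_zero_of_infinite_isRoot _ ((Set.Ioo_infinite hab).mono fun x hx => ?_))
  rw [Set.mem_ofPred, Polynomial.IsRoot.def, eval_restrictLine]
  exact h0 x hx.1 hx.2

/-- Four alternating signs persist on nearby lines and force three real points there, while nearby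
lines include transverse ones. -/
theorem RealPlaneCurve.noFourAlternations {X : RealPlaneCurve}
    (hX : ∀ n ∈ X.possibleNumbers, n ≤ 2) : NoFourAlternations X.form := by
  intro u w t₁ t₂ t₃ t₄ h₁₂ h₂₃ h₃₄ h₁ h₂ h₃ h₄
  let O : Set ((Fin 3 → ℝ) × (Fin 3 → ℝ)) :=
    {z | 0 < eval (z.1 + t₁ • z.2) X.form} ∩ {z | eval (z.1 + t₂ • z.2) X.form < 0} ∩
      {z | 0 < eval (z.1 + t₃ • z.2) X.form} ∩ {z | eval (z.1 + t₄ • z.2) X.form < 0}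
  have hcont : ∀ t : ℝ, Continuous fun z : (Fin 3 → ℝ) × (Fin 3 → ℝ) =>
      eval (z.1 + t • z.2) X.form := fun t =>
    (MvPolynomial.continuous_eval X.form).comp (by fun_prop)
  have hO : IsOpen O :=
    (((isOpen_lt continuous_const (hcont t₁)).inter (isOpen_lt (hcont t₂) continuous_const)).inter
      (isOpen_lt continuous_const (hcont t₃))).inter (isOpen_lt (hcont t₄) continuous_const)
  have hmem : (u, w) ∈ O := ⟨⟨⟨h₁, h₂⟩, h₃⟩, h₄⟩
  obtain ⟨q, hqO, hq⟩ := exists_real_eval_ne_zero (D := X.complexForm) X.irreducible.ne_zero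
    (hO.preimage (Continuous.prodMk_right u)) (u := w) hmem
  have hq' : eval q X.form ≠ 0 := by
    change eval (complexifyVec q) _ ≠ 0 at hq
    rw [RealPlaneCurve.complexForm, eval_complexifyVec] at hq
    exact_mod_cast hq
  obtain ⟨u', hu'O, huq, htr⟩ := RealPlaneCurve.exists_transverse hq'
    (hO.preimage (Continuous.prodMk_left q)) ⟨u, hqO⟩
  obtain ⟨⟨⟨s₁, s₂⟩, s₃⟩, s₄⟩ : (u', q) ∈ O := hu'O
  set S : Set ℝ := {t : ℝ | eval (u' + t • q) X.form = 0} with hS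
  have hfin : S.Finite := RealPlaneCurve.finite_roots huq
  have hn : S.ncard ∈ X.possibleNumbers := by
    refine ⟨u' ⨯₃ q, huq, htr, ?_⟩
    rw [RealPlaneCurve.encard_inter_cross huq hq', ← hfin.cast_ncard_eq]
  obtain ⟨a, ha₁, ha₂, ha⟩ := exists_root_of_sign_change h₁₂ (mul_neg_of_pos_of_neg s₁ s₂)
  obtain ⟨b, hb₁, hb₂, hb⟩ := exists_root_of_sign_change h₂₃ (mul_neg_of_neg_of_pos s₂ s₃)
  obtain ⟨c, hc₁, hc₂, hc⟩ := exists_root_of_sign_change h₃₄ (mul_neg_of_pos_of_neg s₃ s₄)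
  have h3 : 2 < S.ncard := (Set.two_lt_ncard_iff hfin).2
    ⟨a, b, c, ha, hb, hc, by linarith, by linarith, by linarith⟩
  exact absurd (hX _ hn) (by omega)

/-! ### Tangent lines and a disjoint line -/

section Tangent

variable {F : MvPolynomial (Fin 3) ℝ} {d : ℕ}

theorem continuous_eval_comp {α : Type*} [TopologicalSpace α] (F : MvPolynomial (Fin 3) ℝ)
    {f : α → Fin 3 → ℝ} (hf : Continuous f) : Continuous fun x => eval (f x) F :=
  (MvPolynomial.continuous_eval F).comp hf

theorem hasDerivAt_eval_line (F : MvPolynomial (Fin 3) ℝ) (u w : Fin 3 → ℝ) (t : ℝ) :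
    HasDerivAt (fun t : ℝ => eval (u + t • w) F) (eval (u + t • w) (F.dirDeriv w)) t := by
  have h := (F.restrictLine u w).hasDerivAt t
  rw [derivative_restrictLine, eval_restrictLine] at h
  simpa only [eval_restrictLine] using h

theorem eval_dirDeriv_eq_dotProduct (F : MvPolynomial (Fin 3) ℝ) (v w : Fin 3 → ℝ) :
    eval v (F.dirDeriv w) = w ⬝ᵥ fun i => eval v (pderiv i F) :=
  eval_dirDeriv F w v

theorem eventually_eval_neg {p y : Fin 3 → ℝ} (hp : eval p F = 0)
    (hy : eval p (F.dirDeriv y) < 0) : ∀ᶠ δ : ℝ in 𝓝[>] 0, eval (p + δ • y) F < 0 := by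
  have h := hasDerivAt_eval_line F p y 0
  rw [hasDerivAt_iff_tendsto_slope, zero_smul, add_zero] at h
  have h1 := (h.mono_left (nhdsWithin_mono 0 fun x (hx : 0 < x) => hx.ne')).eventually_lt_const hy
  filter_upwards [h1, self_mem_nhdsWithin] with δ hδ (hδ0 : 0 < δ)
  rw [slope_def_field] at hδ
  simp only [zero_smul, add_zero, hp, sub_zero] at hδ
  exact (div_neg_iff.1 hδ).elim (fun h => absurd h.2 hδ0.not_gt) fun h => h.1

/-- A sign change along a tangent line at the point of contact would, after a small rotation of
the line about that point, produce four alternating signs. -/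
theorem NoFourAlternations.not_sign_change (halt : NoFourAlternations F) {v w g : Fin 3 → ℝ}
    (hv : eval v F = 0) (hw : eval v (F.dirDeriv w) = 0) (hg : 0 < eval v (F.dirDeriv g))
    {a b : ℝ} (ha : a < 0) (hb : 0 < b) (hFa : eval (v + a • w) F < 0) :
    ¬ 0 < eval (v + b • w) F := by
  intro hFb
  have hlin : ∀ δ : ℝ, eval v (F.dirDeriv (w - δ • g)) = -(δ * eval v (F.dirDeriv g)) := by
    intro δ
    simp only [eval_dirDeriv_eq_dotProduct] at hw ⊢
    rw [sub_dotProduct, smul_dotProduct, hw, zero_sub, smul_eq_mul]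
  have hc : ∀ x : ℝ, Tendsto (fun δ : ℝ => eval (v + x • (w - δ • g)) F) (𝓝[>] 0)
      (𝓝 (eval (v + x • w) F)) := by
    intro x
    have : Continuous fun δ : ℝ => eval (v + x • (w - δ • g)) F :=
      continuous_eval_comp F (by fun_prop)
    simpa using (this.tendsto 0).mono_left nhdsWithin_le_nhds
  obtain ⟨δ, ⟨h1, h2⟩, hδ : 0 < δ⟩ := (((hc a).eventually_lt_const hFa).and
    ((hc b).eventually_const_lt hFb)).and self_mem_nhdsWithin |>.exists
  set y := w - δ • g with hy
  have hDy : eval v (F.dirDeriv y) < 0 := by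
    rw [hlin]
    have := mul_pos hδ hg
    linarith
  have hDy' : eval v ((-F).dirDeriv (-y)) < 0 := by
    rw [eval_dirDeriv_eq_dotProduct] at hDy ⊢
    simpa [dotProduct] using hDy
  obtain ⟨τ, ⟨⟨h3, h4⟩, h5⟩, hτ : 0 < τ⟩ := (((eventually_eval_neg hv hDy).and
    (eventually_eval_neg (F := -F) (by simpa using hv) hDy')).and
    (nhdsWithin_le_nhds (Iio_mem_nhds (lt_min hb (neg_pos.2 ha))))).and
    self_mem_nhdsWithin |>.exists
  have h5' := lt_min_iff.1 h5
  rw [map_neg, neg_neg_iff_pos, smul_neg, ← neg_smul] at h4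
  exact halt.opposite (by linarith [h5'.2]) (by linarith) h5'.1 h1 h4 h3 h2

theorem dirDeriv_neg_right (F : MvPolynomial (Fin 3) ℝ) (w : Fin 3 → ℝ) :
    F.dirDeriv (-w) = -F.dirDeriv w := by
  simp [dirDeriv]

theorem dirDeriv_neg_left (F : MvPolynomial (Fin 3) ℝ) (w : Fin 3 → ℝ) :
    (-F).dirDeriv w = -F.dirDeriv w := by
  simp [dirDeriv]

/-- The hypotheses on a real ternary form under which a nonempty zero set is an oval: it is
homogeneous and contains no line, its gradient vanishes at no zero, and no line carries four
alternating signs. -/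
structure IsOvalForm (F : MvPolynomial (Fin 3) ℝ) (d : ℕ) : Prop where
  isHomogeneous : F.IsHomogeneous d
  restrictLine_ne_zero : ∀ v w : Fin 3 → ℝ, v ⨯₃ w ≠ 0 → F.restrictLine v w ≠ 0
  exists_pderiv_ne_zero : ∀ v : Fin 3 → ℝ, v ≠ 0 → eval v F = 0 → ∃ i, eval v (pderiv i F) ≠ 0
  noFourAlternations : NoFourAlternations F

namespace IsOvalForm

theorem neg (h : IsOvalForm F d) : IsOvalForm (-F) d where
  isHomogeneous := h.isHomogeneous.neg
  restrictLine_ne_zero v w hvw h0 := by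
    refine h.restrictLine_ne_zero v w hvw ?_
    rwa [restrictLine, map_neg, neg_eq_zero] at h0
  exists_pderiv_ne_zero v hv hF := by
    simpa using h.exists_pderiv_ne_zero v hv (by simpa using hF)
  noFourAlternations := h.noFourAlternations.neg

theorem exists_eval_ne_zero (h : IsOvalForm F d) {v w : Fin 3 → ℝ} (hvw : v ⨯₃ w ≠ 0)
    {a b : ℝ} (hab : a < b) : ∃ x, a < x ∧ x < b ∧ eval (v + x • w) F ≠ 0 :=
  exists_eval_ne_zero_of_restrictLine_ne_zero (h.restrictLine_ne_zero v w hvw) hab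

theorem eval_dirDeriv_self (h : IsOvalForm F d) {v : Fin 3 → ℝ} (hv : eval v F = 0) :
    eval v (F.dirDeriv v) = 0 := by
  rw [eval_dirDeriv, h.isHomogeneous.sum_mul_eval_pderiv, hv, mul_zero]

/-- If two independent directions `v`, `w` are tangent at `p`, then no direction `g` outside their
plane is. -/
theorem eval_dirDeriv_ne_zero (h : IsOvalForm F d) {p v w g : Fin 3 → ℝ} (hp : p ≠ 0)
    (hFp : eval p F = 0) (hvw : v ⨯₃ w ≠ 0) (hpv : eval p (F.dirDeriv v) = 0)
    (hpw : eval p (F.dirDeriv w) = 0) (hg : (v ⨯₃ w) ⬝ᵥ g ≠ 0) : eval p (F.dirDeriv g) ≠ 0 := by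
  intro hpg
  have ha : (v ⨯₃ w) ⬝ᵥ (v ⨯₃ w) ≠ 0 := fun h0 => hvw (dotProduct_self_eq_zero.1 h0)
  rw [eval_dirDeriv_eq_dotProduct] at hpv hpw hpg
  set G : Fin 3 → ℝ := fun i => eval p (pderiv i F) with hG
  have key : ∀ x : Fin 3 → ℝ, ((v ⨯₃ w) ⬝ᵥ (v ⨯₃ w)) * (x ⬝ᵥ G)
      = ((v ⨯₃ w) ⬝ᵥ x) * ((v ⨯₃ w) ⬝ᵥ G) := by
    intro x
    have := congrArg (fun z => z ⬝ᵥ G) (dotProduct_cross_self_expansion v w x)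
    simpa only [add_dotProduct, smul_dotProduct, hpv, hpw, smul_eq_mul, mul_zero, zero_add]
      using this
  have h1 : (v ⨯₃ w) ⬝ᵥ G = 0 := by
    have := key g
    rw [hpg, mul_zero] at this
    exact (mul_eq_zero.1 this.symm).resolve_left hg
  obtain ⟨i, hi⟩ := h.exists_pderiv_ne_zero p hp hFp
  have h2 := key (Pi.single i 1)
  rw [h1, mul_zero, mul_eq_zero, or_iff_right ha, single_one_dotProduct] at h2
  exact hi h2

theorem cross_dotProduct_ne_zero (h : IsOvalForm F d) {v w g : Fin 3 → ℝ} (hv : eval v F = 0)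
    (hw : eval v (F.dirDeriv w) = 0) (hg : eval v (F.dirDeriv g) ≠ 0) (hvw : v ⨯₃ w ≠ 0) :
    (v ⨯₃ w) ⬝ᵥ g ≠ 0 := by
  intro h0
  have ha : (v ⨯₃ w) ⬝ᵥ (v ⨯₃ w) ≠ 0 := fun h0 => hvw (dotProduct_self_eq_zero.1 h0)
  have hvv := h.eval_dirDeriv_self hv
  rw [eval_dirDeriv_eq_dotProduct] at hvv hw hg
  have := congrArg (fun z => z ⬝ᵥ fun i => eval v (pderiv i F))
    (dotProduct_cross_self_expansion v w g)
  simp only [add_dotProduct, smul_dotProduct, hvv, hw, smul_eq_mul, mul_zero, zero_add, h0,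
    zero_mul, mul_eq_zero, or_iff_right ha] at this
  exact hg this

/-- Along a tangent line the form does not take both signs. -/
theorem tangent_semidefinite (h : IsOvalForm F d) {v w g : Fin 3 → ℝ} (hv : eval v F = 0)
    (hw : eval v (F.dirDeriv w) = 0) (hg : 0 < eval v (F.dirDeriv g)) (hvw : v ⨯₃ w ≠ 0) :
    (∀ x : ℝ, 0 ≤ eval (v + x • w) F) ∨ ∀ x : ℝ, eval (v + x • w) F ≤ 0 := by
  have hopp : ∀ a b : ℝ, eval (v + a • w) F < 0 → 0 < eval (v + b • w) F → 0 < a * b := by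
    intro a b ha hb
    have ha0 : a ≠ 0 := by rintro rfl; simp [hv] at ha
    have hb0 : b ≠ 0 := by rintro rfl; simp [hv] at hb
    by_contra! hab
    rcases mul_neg_iff.1 (lt_of_le_of_ne hab (mul_ne_zero ha0 hb0)) with ⟨h1, h2⟩ | ⟨h1, h2⟩
    · refine h.noFourAlternations.not_sign_change (w := -w) hv ?_ hg (neg_neg_iff_pos.2 h1)
        (neg_pos.2 h2) ?_ ?_
      · rw [dirDeriv_neg_right, map_neg, hw, neg_zero]
      · rwa [neg_smul_neg]
      · rwa [neg_smul_neg]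
    · exact h.noFourAlternations.not_sign_change hv hw hg h1 h2 ha hb
  by_contra! hcon
  obtain ⟨⟨a, ha⟩, b, hb⟩ := hcon
  have hab := hopp a b ha hb
  -- A point on the other side of `v` clashes with `a` or with `b`.
  obtain ⟨x, hxa, hx⟩ : ∃ x, x * a < 0 ∧ eval (v + x • w) F ≠ 0 := by
    rcases lt_or_gt_of_ne (left_ne_zero_of_mul hab.ne') with h1 | h1
    · obtain ⟨x, hx, -, hx'⟩ := h.exists_eval_ne_zero hvw (zero_lt_one' ℝ)
      exact ⟨x, mul_neg_of_pos_of_neg hx h1, hx'⟩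
    · obtain ⟨x, -, hx, hx'⟩ := h.exists_eval_ne_zero hvw (neg_one_lt_zero (R := ℝ))
      exact ⟨x, mul_neg_of_neg_of_pos hx h1, hx'⟩
  rcases lt_or_gt_of_ne hx with h1 | h1
  · have := hopp x b h1 hb
    nlinarith [mul_pos hab this, mul_nonneg (neg_nonneg.2 hxa.le) (mul_self_nonneg b)]
  · have := hopp a x ha h1
    linarith [mul_comm a x]

/-- The contact point is the only zero on a tangent line. At a second zero the line would be tangent
as well, and a small displacement would produce four alternating signs. -/
theorem tangent_ne_zero_of_nonneg (h : IsOvalForm F d) {v w g : Fin 3 → ℝ} (hv : eval v F = 0)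
    (hw : eval v (F.dirDeriv w) = 0) (hg : 0 < eval v (F.dirDeriv g)) (hvw : v ⨯₃ w ≠ 0)
    (hnn : ∀ x : ℝ, 0 ≤ eval (v + x • w) F) {x : ℝ} (hx : 0 < x) : eval (v + x • w) F ≠ 0 := by
  intro hx0
  set p := v + x • w with hp
  have hDw : eval p (F.dirDeriv w) = 0 := by
    refine IsLocalMin.hasDerivAt_eq_zero ?_ (hasDerivAt_eval_line F v w x)
    refine Eventually.of_forall fun y => ?_
    change eval (v + x • w) F ≤ _
    rw [← hp, hx0]
    exact hnn y
  have hp0 : p ≠ 0 := by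
    intro h0
    apply hvw
    rw [eq_neg_of_add_eq_zero_left (hp.symm.trans h0)]
    simp
  have hDv : eval p (F.dirDeriv v) = 0 := by
    have h1 := h.eval_dirDeriv_self hx0
    rw [eval_dirDeriv_eq_dotProduct] at h1 hDw ⊢
    nth_rewrite 1 [hp] at h1
    rwa [add_dotProduct, smul_dotProduct, hDw, smul_zero, add_zero] at h1
  have hDg : eval p (F.dirDeriv g) ≠ 0 :=
    h.eval_dirDeriv_ne_zero hp0 hx0 hvw hDv hDw (h.cross_dotProduct_ne_zero hv hw hg.ne' hvw)
  have hsmul : ∀ (q : Fin 3 → ℝ) (c : ℝ), eval q (F.dirDeriv (c • g)) = c * eval q (F.dirDeriv g) :=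
    fun q c => by rw [eval_dirDeriv_eq_dotProduct, smul_dotProduct, eval_dirDeriv_eq_dotProduct,
      smul_eq_mul]
  -- The displacement `-1 + κ x` is `-1` at the first zero and has the decreasing direction of `F`
  -- at the second.
  obtain ⟨κ, hκ⟩ : ∃ κ : ℝ, (-1 + κ * x) * eval p (F.dirDeriv g) < 0 := by
    rcases lt_or_gt_of_ne hDg with h1 | h1
    · refine ⟨2 / x, ?_⟩
      rw [div_mul_cancel₀ _ hx.ne']
      linarith
    · exact ⟨0, by linarith⟩
  obtain ⟨a, -, ha, ha'⟩ := h.exists_eval_ne_zero hvw (neg_one_lt_zero (R := ℝ))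
  obtain ⟨b, hb, hbx, hb'⟩ := h.exists_eval_ne_zero hvw hx
  have hline : ∀ δ y : ℝ, (v - δ • g) + y • (w + (δ * κ) • g)
      = v + y • w + δ • ((-1 + κ * y) • g) := by
    intro δ y
    module
  have hpos : ∀ y : ℝ, eval (v + y • w) F ≠ 0 →
      ∀ᶠ δ : ℝ in 𝓝[>] 0, 0 < eval (v + y • w + δ • ((-1 + κ * y) • g)) F := by
    intro y hy
    have hc : Continuous fun δ : ℝ => eval (v + y • w + δ • ((-1 + κ * y) • g)) F :=
      continuous_eval_comp F (by fun_prop)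
    have ht := (hc.tendsto 0).mono_left (nhdsWithin_le_nhds (s := Set.Ioi 0))
    rw [zero_smul, add_zero] at ht
    exact ht.eventually_const_lt (lt_of_le_of_ne (hnn y) hy.symm)
  have hneg0 : ∀ᶠ δ : ℝ in 𝓝[>] 0, eval (v + (0 : ℝ) • w + δ • ((-1 + κ * 0) • g)) F < 0 := by
    rw [zero_smul, add_zero]
    refine eventually_eval_neg hv ?_
    rw [hsmul]
    linarith
  have hnegx : ∀ᶠ δ : ℝ in 𝓝[>] 0, eval (v + x • w + δ • ((-1 + κ * x) • g)) F < 0 :=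
    eventually_eval_neg hx0 (by rwa [hsmul])
  obtain ⟨δ, ⟨⟨h1, h2⟩, h3⟩, h4⟩ :=
    (((hpos a ha').and hneg0).and (hpos b hb')).and hnegx |>.exists
  rw [← hline] at h1 h2 h3 h4
  exact h.noFourAlternations _ _ _ _ _ _ ha hb hbx h1 h2 h3 h4

theorem tangent_ne_zero (h : IsOvalForm F d) {v w g : Fin 3 → ℝ} (hv : eval v F = 0)
    (hw : eval v (F.dirDeriv w) = 0) (hg : 0 < eval v (F.dirDeriv g)) (hvw : v ⨯₃ w ≠ 0)
    {x : ℝ} (hx : x ≠ 0) : eval (v + x • w) F ≠ 0 := by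
  wlog hxpos : 0 < x generalizing w x
  · have := this (w := -w) (by rw [dirDeriv_neg_right, map_neg, hw, neg_zero])
      (by rw [map_neg]; exact neg_ne_zero.2 hvw) (x := -x) (neg_ne_zero.2 hx)
      (neg_pos.2 (lt_of_le_of_ne (not_lt.1 hxpos) hx))
    rwa [neg_smul_neg] at this
  rcases h.tangent_semidefinite hv hw hg hvw with h1 | h1
  · exact h.tangent_ne_zero_of_nonneg hv hw hg hvw h1 hxpos
  · have := h.neg.tangent_ne_zero_of_nonneg (v := v) (w := w) (g := -g) (x := x) (by simpa using hv)
      (by rw [dirDeriv_neg_left, map_neg, hw, neg_zero])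
      (by rwa [dirDeriv_neg_left, dirDeriv_neg_right, neg_neg]) hvw (fun y => by simpa using h1 y)
      hxpos
    simpa using this

/-- Pushing a tangent line slightly to the side on which the form keeps its sign makes it disjoint
from the zero set. -/
theorem exists_disjoint_line_of_nonneg (h : IsOvalForm F d) {v w g : Fin 3 → ℝ} (hv : eval v F = 0)
    (hw : eval v (F.dirDeriv w) = 0) (hg : 0 < eval v (F.dirDeriv g)) (hvw : v ⨯₃ w ≠ 0)
    (hnn : ∀ x : ℝ, 0 ≤ eval (v + x • w) F) :
    ∃ u₁ u₂ : Fin 3 → ℝ, ∀ s t : ℝ, (s, t) ≠ 0 → eval (s • u₁ + t • u₂) F ≠ 0 := by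
  -- The points of the tangent line other than `v`, first in the chart around `v`, then around `w`.
  have hne₁ : ∀ x : ℝ, x ≠ 0 → eval (v + x • w) F ≠ 0 := fun x hx =>
    h.tangent_ne_zero hv hw hg hvw hx
  have hne₂ : ∀ s : ℝ, eval (w + s • v) F ≠ 0 := by
    intro s
    have hDw : eval v (F.dirDeriv (w + (s - 1) • v)) = 0 := by
      have hvv := h.eval_dirDeriv_self hv
      rw [eval_dirDeriv_eq_dotProduct] at hvv hw ⊢
      rw [add_dotProduct, smul_dotProduct, hw, hvv, smul_zero, add_zero]
    have := h.tangent_ne_zero hv hDw hg (by simpa using hvw) one_ne_zero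
    have he : v + (1 : ℝ) • (w + (s - 1) • v) = w + s • v := by module
    rwa [he] at this
  have hK : IsCompact (Set.Icc (-1 : ℝ) 1) := isCompact_Icc
  have hA : ∀ᶠ δ : ℝ in 𝓝 0, ∀ x ∈ Set.Icc (-1 : ℝ) 1, 0 < δ →
      eval (v + δ • g + x • w) F ≠ 0 := by
    refine hK.eventually_forall_of_forall_eventually fun x _ => ?_
    have hc : Continuous fun z : ℝ × ℝ => eval (v + z.1 • g + z.2 • w) F :=
      continuous_eval_comp F (by fun_prop)
    rcases eq_or_ne x 0 with rfl | hx
    · -- Near `v` the form increases in the direction `g`.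
      have hc' : Continuous fun z : ℝ × ℝ => eval (v + z.1 • g + z.2 • w) (F.dirDeriv g) :=
        continuous_eval_comp _ (by fun_prop)
      have h1 : ∀ᶠ z : ℝ × ℝ in 𝓝 (0, 0), 0 < eval (v + z.1 • g + z.2 • w) (F.dirDeriv g) := by
        refine (hc'.tendsto (0, 0)).eventually_const_lt ?_
        simpa using hg
      obtain ⟨r, hr, hball⟩ := Metric.eventually_nhds_iff.1 h1
      refine Metric.eventually_nhds_iff.2 ⟨r, hr, fun z hz hz0 => ?_⟩
      obtain ⟨δ, x⟩ := z
      rw [Prod.dist_eq, max_lt_iff, Real.dist_eq, Real.dist_eq, sub_zero, sub_zero] at hz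
      dsimp only at hz hz0 ⊢
      have hmono : StrictMonoOn (fun s : ℝ => eval ((v + x • w) + s • g) F) (Set.Icc 0 δ) := by
        refine strictMonoOn_of_deriv_pos (convex_Icc 0 δ)
          (continuous_eval_comp F (by fun_prop)).continuousOn fun s hs => ?_
        rw [interior_Icc] at hs
        rw [(hasDerivAt_eval_line F _ g s).deriv]
        have hsr : dist (s, x) ((0 : ℝ), (0 : ℝ)) < r := by
          rw [Prod.dist_eq, max_lt_iff, Real.dist_eq, Real.dist_eq, sub_zero, sub_zero,
            abs_of_pos hs.1]
          rw [abs_of_pos hz0] at hz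
          exact ⟨hs.2.trans hz.1, hz.2⟩
        have := hball hsr
        rwa [add_right_comm] at this
      have h2 := hmono (Set.left_mem_Icc.2 hz0.le) (Set.right_mem_Icc.2 hz0.le) hz0
      simp only [zero_smul, add_zero] at h2
      rw [add_right_comm]
      exact ((hnn x).trans_lt h2).ne'
    · have h1 : ∀ᶠ z : ℝ × ℝ in 𝓝 (0, x), eval (v + z.1 • g + z.2 • w) F ≠ 0 := by
        refine hc.continuousAt.eventually_ne ?_
        simpa using hne₁ x hx
      exact h1.mono fun z hz _ => hz
  have hB : ∀ᶠ δ : ℝ in 𝓝 0, ∀ s ∈ Set.Icc (-1 : ℝ) 1, eval (w + s • (v + δ • g)) F ≠ 0 := by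
    refine hK.eventually_forall_of_forall_eventually fun s _ => ?_
    have hc : Continuous fun z : ℝ × ℝ => eval (w + z.2 • (v + z.1 • g)) F :=
      continuous_eval_comp F (by fun_prop)
    refine hc.continuousAt.eventually_ne ?_
    simpa using hne₂ s
  obtain ⟨δ, ⟨h1, h2⟩, hδ : 0 < δ⟩ := ((hA.and hB).filter_mono nhdsWithin_le_nhds).and
    (self_mem_nhdsWithin (s := Set.Ioi (0 : ℝ))) |>.exists
  refine ⟨v + δ • g, w, fun s t hst => ?_⟩
  have hratio : ∀ {a b : ℝ}, |b| ≤ |a| → b / a ∈ Set.Icc (-1 : ℝ) 1 := fun {a b} hab => by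
    rw [Set.mem_Icc, ← abs_le, abs_div]
    exact div_le_one_of_le₀ hab (abs_nonneg a)
  rcases le_total |t| |s| with hle | hle
  · have hs : s ≠ 0 := by
      rintro rfl
      have ht : t = 0 := by simpa using hle
      exact hst (by rw [ht]; rfl)
    have : s • (v + δ • g) + t • w = s • (v + δ • g + (t / s) • w) := by
      rw [smul_add s (v + δ • g), smul_smul, mul_div_cancel₀ _ hs]
    rw [this, h.isHomogeneous.eval_smul]
    exact mul_ne_zero (pow_ne_zero _ hs) (h1 _ (hratio hle) hδ)
  · have ht : t ≠ 0 := by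
      rintro rfl
      have hs : s = 0 := by simpa using hle
      exact hst (by rw [hs]; rfl)
    have : s • (v + δ • g) + t • w = t • (w + (s / t) • (v + δ • g)) := by
      rw [smul_add t w, smul_smul, mul_div_cancel₀ _ ht, add_comm]
    rw [this, h.isHomogeneous.eval_smul]
    exact mul_ne_zero (pow_ne_zero _ ht) (h2 _ (hratio hle))

theorem exists_disjoint_line (h : IsOvalForm F d) {v : Fin 3 → ℝ} (hv0 : v ≠ 0)
    (hv : eval v F = 0) :
    ∃ u₁ u₂ : Fin 3 → ℝ, ∀ s t : ℝ, (s, t) ≠ 0 → eval (s • u₁ + t • u₂) F ≠ 0 := by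
  set G : Fin 3 → ℝ := fun i => eval v (pderiv i F) with hG
  have hG0 : G ≠ 0 := by
    obtain ⟨i, hi⟩ := h.exists_pderiv_ne_zero v hv0 hv
    exact fun h0 => hi (congrFun h0 i)
  have hGv : v ⬝ᵥ G = 0 := by
    rw [← eval_dirDeriv_eq_dotProduct]
    exact h.eval_dirDeriv_self hv
  have hGG : 0 < G ⬝ᵥ G := by
    refine lt_of_le_of_ne (Finset.sum_nonneg fun i _ => mul_self_nonneg _) fun h0 => ?_
    exact hG0 (dotProduct_self_eq_zero.1 h0.symm)
  have hg : 0 < eval v (F.dirDeriv G) := by rwa [eval_dirDeriv_eq_dotProduct]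
  have hw : eval v (F.dirDeriv (G ⨯₃ v)) = 0 := by
    rw [eval_dirDeriv_eq_dotProduct, dotProduct_comm]
    exact dot_self_cross G v
  have hvw : v ⨯₃ (G ⨯₃ v) ≠ 0 := by
    rw [cross_cross_eq_smul_sub_smul', dotProduct_comm G v, hGv, zero_smul, sub_zero]
    exact smul_ne_zero (fun h0 => hv0 (dotProduct_self_eq_zero.1 h0)) hG0
  rcases h.tangent_semidefinite hv hw hg hvw with h1 | h1
  · exact h.exists_disjoint_line_of_nonneg hv hw hg hvw h1
  · obtain ⟨u₁, u₂, hu⟩ := h.neg.exists_disjoint_line_of_nonneg (v := v) (w := G ⨯₃ v) (g := -G)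
      (by simpa using hv) (by rw [dirDeriv_neg_left, map_neg, hw, neg_zero])
      (by rwa [dirDeriv_neg_left, dirDeriv_neg_right, neg_neg]) hvw (fun y => by simpa using h1 y)
    exact ⟨u₁, u₂, fun s t hst => by simpa using hu s t hst⟩

end IsOvalForm

end Tangent

/-! ### The affine chart `q ↦ e ![q.1, q.2, 1]`, with directions `e ![w.1, w.2, 0]` -/

section Chart

variable {F : MvPolynomial (Fin 3) ℝ} {d : ℕ} (e : (Fin 3 → ℝ) ≃ₗ[ℝ] (Fin 3 → ℝ))

theorem chart_add_smul (q w : ℝ × ℝ) (t : ℝ) :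
    e ![(q + t • w).1, (q + t • w).2, 1] = e ![q.1, q.2, 1] + t • e ![w.1, w.2, 0] := by
  rw [← map_smul, ← map_add]
  simp

theorem chart_ne_zero (q : ℝ × ℝ) : e ![q.1, q.2, 1] ≠ 0 := by
  rw [Ne, LinearEquiv.map_eq_zero_iff]
  exact fun h => one_ne_zero (congrFun h 2)

theorem map_affinePoint (q : ℝ × ℝ) :
    Projectivization.map e.toLinearMap e.injective (affinePoint q)
      = Projectivization.mk ℝ (e ![q.1, q.2, 1]) (chart_ne_zero e q) :=
  rfl

theorem continuous_chart_eval (F : MvPolynomial (Fin 3) ℝ) :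
    Continuous fun q : ℝ × ℝ => eval (e ![q.1, q.2, 1]) F := by
  refine continuous_eval_comp F ((LinearMap.continuous_of_finiteDimensional e.toLinearMap).comp ?_)
  fun_prop

namespace IsOvalForm

variable {e}

/-- A form that is positive on the line at infinity is positive far away in the affine chart. -/
theorem exists_radius (h : IsOvalForm F d)
    (hpos : ∀ w : ℝ × ℝ, w ≠ 0 → 0 < eval (e ![w.1, w.2, 0]) F) :
    ∃ ρ : ℝ, ∀ q : ℝ × ℝ, ρ < ‖q‖ → 0 < eval (e ![q.1, q.2, 1]) F := by
  have hK : ∀ᶠ ε : ℝ in 𝓝 0, ∀ z ∈ Metric.sphere (0 : ℝ × ℝ) 1,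
      0 < eval (e ![z.1, z.2, ε]) F := by
    refine (isCompact_sphere 0 1).eventually_forall_of_forall_eventually fun z hz => ?_
    have hc : Continuous fun y : ℝ × ℝ × ℝ => eval (e ![y.2.1, y.2.2, y.1]) F := by
      refine continuous_eval_comp F
        ((LinearMap.continuous_of_finiteDimensional e.toLinearMap).comp ?_)
      fun_prop
    exact (hc.tendsto (0, z)).eventually_const_lt (hpos z (ne_zero_of_mem_unit_sphere ⟨z, hz⟩))
  obtain ⟨ε, hε, hball⟩ := Metric.eventually_nhds_iff.1 hK
  refine ⟨ε⁻¹, fun q hq => ?_⟩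
  have hq0 : 0 < ‖q‖ := (inv_pos.2 hε).trans hq
  have h1 : 0 < eval (e ![‖q‖⁻¹ * q.1, ‖q‖⁻¹ * q.2, ‖q‖⁻¹]) F := by
    refine hball ?_ (‖q‖⁻¹ * q.1, ‖q‖⁻¹ * q.2) ?_
    · rw [Real.dist_eq, sub_zero, abs_of_pos (inv_pos.2 hq0)]
      exact inv_lt_of_inv_lt₀ hε hq
    · rw [mem_sphere_zero_iff_norm]
      change ‖‖q‖⁻¹ • q‖ = 1
      rw [norm_smul, norm_inv, norm_norm, inv_mul_cancel₀ hq0.ne']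
  have h2 : e ![q.1, q.2, 1] = ‖q‖ • e ![‖q‖⁻¹ * q.1, ‖q‖⁻¹ * q.2, ‖q‖⁻¹] := by
    rw [← map_smul]
    simp [mul_inv_cancel_left₀ hq0.ne', mul_inv_cancel₀ hq0.ne']
  rw [h2, h.isHomogeneous.eval_smul]
  exact mul_pos (pow_pos hq0 d) h1

/-- Zeros are limits of points where the form is negative, because the gradient does not vanish and
is not normal to the affine chart, by Euler's identity. -/
theorem mem_closure_neg (h : IsOvalForm F d) {q : ℝ × ℝ} (hq : eval (e ![q.1, q.2, 1]) F = 0) :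
    q ∈ closure {q : ℝ × ℝ | eval (e ![q.1, q.2, 1]) F < 0} := by
  obtain ⟨w, hw⟩ : ∃ w : ℝ × ℝ,
      eval (e ![q.1, q.2, 1]) (F.dirDeriv (e ![w.1, w.2, 0])) ≠ 0 := by
    by_contra! h0
    obtain ⟨i, hi⟩ := h.exists_pderiv_ne_zero _ (chart_ne_zero e q) hq
    have hself := h.eval_dirDeriv_self hq
    set y := e.symm (Pi.single i 1) with hy
    have hdec : (Pi.single i 1 : Fin 3 → ℝ)
        = e ![y 0 - y 2 * q.1, y 1 - y 2 * q.2, 0] + y 2 • e ![q.1, q.2, 1] := by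
      rw [← map_smul, ← map_add, ← LinearEquiv.symm_apply_eq, ← hy]
      ext j
      fin_cases j <;> simp
    have h1 := h0 (y 0 - y 2 * q.1, y 1 - y 2 * q.2)
    rw [eval_dirDeriv_eq_dotProduct] at hself h1
    have h2 := congrArg (fun z => z ⬝ᵥ fun i => eval (e ![q.1, q.2, 1]) (pderiv i F)) hdec
    simp only [add_dotProduct, smul_dotProduct, h1, hself, single_one_dotProduct, smul_zero,
      add_zero] at h2
    exact hi h2
  obtain ⟨w, hw⟩ : ∃ w : ℝ × ℝ,
      eval (e ![q.1, q.2, 1]) (F.dirDeriv (e ![w.1, w.2, 0])) < 0 := by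
    rcases lt_or_gt_of_ne hw with h1 | h1
    · exact ⟨w, h1⟩
    · refine ⟨-w, ?_⟩
      have : e ![(-w).1, (-w).2, 0] = -e ![w.1, w.2, 0] := by
        rw [← map_neg]
        simp
      rw [this, dirDeriv_neg_right, map_neg]
      linarith
  have hlim : Tendsto (fun δ : ℝ => q + δ • w) (𝓝[>] 0) (𝓝 q) := by
    have : Continuous fun δ : ℝ => q + δ • w := by fun_prop
    simpa using (this.tendsto 0).mono_left (nhdsWithin_le_nhds (s := Set.Ioi 0))
  refine mem_closure_of_tendsto hlim ?_
  filter_upwards [eventually_eval_neg hq hw] with δ hδ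
  rw [chart_add_smul]
  exact hδ

theorem mem_closure_pos (h : IsOvalForm F d) {q : ℝ × ℝ} (hq : eval (e ![q.1, q.2, 1]) F = 0) :
    q ∈ closure {q : ℝ × ℝ | 0 < eval (e ![q.1, q.2, 1]) F} := by
  simpa using h.neg.mem_closure_neg (e := e) (q := q) (by simpa using hq)

/-- A positive value between two negative ones would give four alternating signs, since the form is
positive far away. -/
theorem nonpos_of_neg (h : IsOvalForm F d)
    (hpos : ∀ w : ℝ × ℝ, w ≠ 0 → 0 < eval (e ![w.1, w.2, 0]) F) {a b : ℝ × ℝ}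
    (ha : eval (e ![a.1, a.2, 1]) F < 0) (hb : eval (e ![b.1, b.2, 1]) F < 0) {θ : ℝ}
    (hθ0 : 0 ≤ θ) (hθ1 : θ ≤ 1) :
    eval (e ![(a + θ • (b - a)).1, (a + θ • (b - a)).2, 1]) F ≤ 0 := by
  by_contra! hc
  obtain ⟨ρ, hρ⟩ := h.exists_radius hpos
  have hba : b - a ≠ 0 := by
    intro h0
    rw [h0, smul_zero, add_zero] at hc
    exact ha.not_gt hc
  have hba' : 0 < ‖b - a‖ := norm_pos_iff.2 hba
  obtain ⟨T, hT, hT0⟩ : ∃ T : ℝ, 0 < eval (e ![(a + T • (b - a)).1, (a + T • (b - a)).2, 1]) F ∧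
      T < 0 := by
    have hnum : 0 < (|ρ| + ‖a‖ + 1) / ‖b - a‖ := by positivity
    refine ⟨-((|ρ| + ‖a‖ + 1) / ‖b - a‖), hρ _ ?_, neg_neg_iff_pos.2 hnum⟩
    have h1 : ‖-((|ρ| + ‖a‖ + 1) / ‖b - a‖) • (b - a)‖ = |ρ| + ‖a‖ + 1 := by
      rw [norm_smul, norm_neg, Real.norm_of_nonneg hnum.le, div_mul_cancel₀ _ hba'.ne']
    have h2 := norm_sub_le (a + -((|ρ| + ‖a‖ + 1) / ‖b - a‖) • (b - a)) a
    rw [add_sub_cancel_left, h1] at h2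
    linarith [le_abs_self ρ]
  have hθ0' : 0 < θ := by
    refine lt_of_le_of_ne hθ0 ?_
    rintro rfl
    rw [zero_smul, add_zero] at hc
    exact ha.not_gt hc
  have hθ1' : θ < 1 := by
    refine lt_of_le_of_ne hθ1 ?_
    rintro rfl
    rw [one_smul, add_sub_cancel] at hc
    exact hb.not_gt hc
  rw [chart_add_smul] at hc hT
  refine h.noFourAlternations _ _ _ _ _ _ hT0 hθ0' hθ1' hT ?_ hc ?_
  · rwa [zero_smul, add_zero]
  · rwa [← chart_add_smul, one_smul, add_sub_cancel]

theorem convex_nonpos (h : IsOvalForm F d)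
    (hpos : ∀ w : ℝ × ℝ, w ≠ 0 → 0 < eval (e ![w.1, w.2, 0]) F) :
    Convex ℝ {q : ℝ × ℝ | eval (e ![q.1, q.2, 1]) F ≤ 0} := by
  have hsub : {q : ℝ × ℝ | eval (e ![q.1, q.2, 1]) F ≤ 0}
      ⊆ closure {q : ℝ × ℝ | eval (e ![q.1, q.2, 1]) F < 0} := by
    intro q hq
    rcases lt_or_eq_of_le (show eval (e ![q.1, q.2, 1]) F ≤ 0 from hq) with h1 | h1
    · exact subset_closure h1
    · exact h.mem_closure_neg h1
  rw [convex_iff_segment_subset]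
  intro a ha b hb c hc
  rw [segment_eq_image'] at hc
  obtain ⟨θ, hθ, rfl⟩ := hc
  -- Otherwise positivity at `a + θ (b - a)` persists for negative points near `a` and `b`.
  by_contra hcon
  rw [Set.mem_ofPred, not_le] at hcon
  have hcont : Continuous fun z : (ℝ × ℝ) × (ℝ × ℝ) =>
      eval (e ![(z.1 + θ • (z.2 - z.1)).1, (z.1 + θ • (z.2 - z.1)).2, 1]) F :=
    (continuous_chart_eval e F).comp
      (by fun_prop : Continuous fun z : (ℝ × ℝ) × (ℝ × ℝ) => z.1 + θ • (z.2 - z.1))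
  have hab : (a, b) ∈ closure ({q : ℝ × ℝ | eval (e ![q.1, q.2, 1]) F < 0} ×ˢ
      {q : ℝ × ℝ | eval (e ![q.1, q.2, 1]) F < 0}) := by
    rw [closure_prod_eq]
    exact ⟨hsub ha, hsub hb⟩
  obtain ⟨z, hz, hz1, hz2⟩ := mem_closure_iff.1 hab _ (isOpen_lt continuous_const hcont) hcon
  exact (h.nonpos_of_neg hpos hz1 hz2 hθ.1 hθ.2).not_gt hz

theorem interior_nonpos (h : IsOvalForm F d) :
    interior {q : ℝ × ℝ | eval (e ![q.1, q.2, 1]) F ≤ 0}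
      = {q : ℝ × ℝ | eval (e ![q.1, q.2, 1]) F < 0} := by
  refine Set.Subset.antisymm (fun q hq => ?_) (interior_maximal
    (fun q (hq : eval (e ![q.1, q.2, 1]) F < 0) => hq.le)
    (isOpen_lt (continuous_chart_eval e F) continuous_const))
  have hq0 : q ∈ {q : ℝ × ℝ | eval (e ![q.1, q.2, 1]) F ≤ 0} := interior_subset hq
  have hle : eval (e ![q.1, q.2, 1]) F ≤ 0 := hq0
  refine lt_of_le_of_ne hle fun h0 => ?_
  obtain ⟨z, hz, hz'⟩ := mem_closure_iff.1 (h.mem_closure_pos h0) _ isOpen_interior hq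
  have hz0 : z ∈ {q : ℝ × ℝ | eval (e ![q.1, q.2, 1]) F ≤ 0} := interior_subset hz
  exact not_lt_of_ge (show eval (e ![z.1, z.2, 1]) F ≤ 0 from hz0) hz'

theorem frontier_nonpos (h : IsOvalForm F d) :
    frontier {q : ℝ × ℝ | eval (e ![q.1, q.2, 1]) F ≤ 0}
      = {q : ℝ × ℝ | eval (e ![q.1, q.2, 1]) F = 0} := by
  rw [frontier, h.interior_nonpos,
    (isClosed_le (continuous_chart_eval e F) continuous_const).closure_eq]
  ext q
  simp only [Set.mem_sdiff, Set.mem_ofPred, not_lt]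
  exact ⟨fun hq => le_antisymm hq.1 hq.2, fun hq => ⟨hq.le, hq.ge⟩⟩

theorem convexHull_zeros (h : IsOvalForm F d)
    (hpos : ∀ w : ℝ × ℝ, w ≠ 0 → 0 < eval (e ![w.1, w.2, 0]) F) :
    convexHull ℝ {q : ℝ × ℝ | eval (e ![q.1, q.2, 1]) F = 0}
      = {q : ℝ × ℝ | eval (e ![q.1, q.2, 1]) F ≤ 0} := by
  refine Set.Subset.antisymm (convexHull_min (fun q hq => le_of_eq hq) (h.convex_nonpos hpos))
    fun q hq => ?_
  rcases lt_or_eq_of_le (show eval (e ![q.1, q.2, 1]) F ≤ 0 from hq) with h1 | h1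
  swap
  · exact subset_convexHull ℝ _ h1
  obtain ⟨ρ, hρ⟩ := h.exists_radius hpos
  -- A horizontal line through a negative point meets the zero set on both sides.
  have hfar : ∀ t : ℝ, |t| = |ρ| + ‖q‖ + 1 →
      0 < eval (e ![q.1, q.2, 1] + t • e ![1, 0, 0]) F := by
    intro t ht
    have h2 := norm_sub_le (q + t • ((1, 0) : ℝ × ℝ)) q
    rw [add_sub_cancel_left, norm_smul, Real.norm_eq_abs, ht] at h2
    have h3 : ‖((1, 0) : ℝ × ℝ)‖ = 1 := by simp [Prod.norm_def]
    rw [h3, mul_one] at h2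
    have h4 := hρ (q + t • (1, 0)) (by linarith [le_abs_self ρ])
    rwa [chart_add_smul] at h4
  have hR : 0 < |ρ| + ‖q‖ + 1 := by positivity
  have h0 : eval (e ![q.1, q.2, 1] + (0 : ℝ) • e ![1, 0, 0]) F < 0 := by rwa [zero_smul, add_zero]
  obtain ⟨s, -, hs, hs'⟩ := exists_root_of_sign_change (neg_neg_iff_pos.2 hR)
    (mul_neg_of_pos_of_neg (hfar _ (by rw [abs_neg, abs_of_pos hR])) h0)
  obtain ⟨t, ht, -, ht'⟩ := exists_root_of_sign_change hR
    (mul_neg_of_neg_of_pos h0 (hfar _ (abs_of_pos hR)))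
  have hmem : ∀ x : ℝ, eval (e ![q.1, q.2, 1] + x • e ![1, 0, 0]) F = 0 →
      q + x • ((1, 0) : ℝ × ℝ) ∈ {q : ℝ × ℝ | eval (e ![q.1, q.2, 1]) F = 0} := by
    intro x hx
    rw [Set.mem_ofPred, chart_add_smul]
    exact hx
  refine segment_subset_convexHull (hmem s hs') (hmem t ht') ?_
  have hts : 0 < t - s := by linarith
  refine ⟨t / (t - s), -s / (t - s), by positivity, div_nonneg (by linarith) hts.le, ?_, ?_⟩
  · rw [← add_div, ← sub_eq_add_neg, div_self hts.ne']
  · have h5 : t / (t - s) + -s / (t - s) = 1 := by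
      rw [← add_div, ← sub_eq_add_neg, div_self hts.ne']
    have h6 : t / (t - s) * s + -s / (t - s) * t = 0 := by ring
    calc _ = (t / (t - s) + -s / (t - s)) • q
          + (t / (t - s) * s + -s / (t - s) * t) • ((1, 0) : ℝ × ℝ) := by module
      _ = q := by rw [h5, h6, one_smul, zero_smul, add_zero]

/-- The zero set is the frontier of a bounded convex set with nonempty interior; a homeomorphism of
`ℂ` carries it to the unit circle. -/
theorem exists_parametrization (h : IsOvalForm F d)
    (hpos : ∀ w : ℝ × ℝ, w ≠ 0 → 0 < eval (e ![w.1, w.2, 0]) F)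
    (hne : ∃ q : ℝ × ℝ, eval (e ![q.1, q.2, 1]) F = 0) :
    ∃ γ : Circle → ℝ × ℝ, Continuous γ ∧ Function.Injective γ ∧
      frontier (convexHull ℝ (Set.range γ)) = Set.range γ ∧
      Set.range γ = {q : ℝ × ℝ | eval (e ![q.1, q.2, 1]) F = 0} := by
  set M := {q : ℝ × ℝ | eval (e ![q.1, q.2, 1]) F ≤ 0} with hM
  let L : ℂ ≃L[ℝ] ℝ × ℝ := Complex.equivRealProdCLM
  have hint : (interior M).Nonempty := by
    obtain ⟨q, hq⟩ := hne
    rw [hM, h.interior_nonpos]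
    exact closure_nonempty_iff.1 ⟨q, h.mem_closure_neg hq⟩
  have hbdd : Bornology.IsBounded M := by
    obtain ⟨ρ, hρ⟩ := h.exists_radius hpos
    refine (Metric.isBounded_closedBall (x := (0 : ℝ × ℝ)) (r := ρ)).subset fun q hq => ?_
    rw [mem_closedBall_zero_iff]
    by_contra! hlt
    exact (hρ q hlt).not_ge hq
  obtain ⟨φ, -, -, hφ⟩ := exists_homeomorph_image_interior_closure_frontier_eq_unitBall
    (s := L ⁻¹' M) ((h.convex_nonpos hpos).linear_preimage L.toLinearMap)
    (by
      change (interior (L.toHomeomorph ⁻¹' M)).Nonempty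
      rw [← L.toHomeomorph.preimage_interior]
      exact hint.preimage L.surjective)
    (by
      rw [← L.image_symm_eq_preimage]
      exact L.symm.lipschitz.isBounded_image hbdd)
  have hrange : Set.range (fun c : Circle => L (φ.symm c))
      = {q : ℝ × ℝ | eval (e ![q.1, q.2, 1]) F = 0} := by
    rw [← h.frontier_nonpos, ← hM]
    have h1 : frontier (L ⁻¹' M) = L ⁻¹' frontier M := (L.toHomeomorph.preimage_frontier M).symm
    have h2 : Set.range (fun c : Circle => c.1) = Metric.sphere 0 1 := by
      ext z
      constructor
      · rintro ⟨c, rfl⟩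
        exact mem_sphere_zero_iff_norm.2 (Circle.norm_coe c)
      · intro hz
        exact ⟨⟨z, hz⟩, rfl⟩
    have h3 : φ.symm '' (φ '' frontier (L ⁻¹' M)) = frontier (L ⁻¹' M) :=
      φ.toEquiv.symm_image_image _
    rw [Set.range_comp' L, Set.range_comp' φ.symm, h2, ← hφ, h3, h1,
      Set.image_preimage_eq _ L.surjective]
  refine ⟨fun c => L (φ.symm c), by fun_prop, ?_, ?_, hrange⟩
  · exact L.injective.comp (φ.symm.injective.comp Subtype.val_injective)
  · rw [hrange, h.convexHull_zeros hpos, h.frontier_nonpos]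

end IsOvalForm

end Chart

/-! ### Curves with at most two real points on each transverse line -/

theorem RealPlaneCurve.isConvexOval_of_bounded {X : RealPlaneCurve} (hX : X.IsSmooth)
    (hne : X.realPoints.Nonempty) (hN : ∀ n ∈ X.possibleNumbers, n ≤ 2) :
    IsConvexOval X.realPoints := by
  have h : IsOvalForm X.form X.degree :=
    { isHomogeneous := X.isHomogeneous
      restrictLine_ne_zero := fun v w hvw => RealPlaneCurve.restrictLine_ne_zero hvw
      exists_pderiv_ne_zero := fun v hv hF => hX.exists_pderiv_ne_zero hv hF
      noFourAlternations := RealPlaneCurve.noFourAlternations hN }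
  obtain ⟨v, hv0, hv⟩ : ∃ v : Fin 3 → ℝ, v ≠ 0 ∧ eval v X.form = 0 := by
    obtain ⟨p, hp⟩ := hne
    induction p using Projectivization.ind with | h v hv =>
    exact ⟨v, hv, (X.mk_mem_realPoints hv).1 hp⟩
  obtain ⟨u₁, u₂, hu⟩ := h.exists_disjoint_line hv0 hv
  -- The projective frame that sends the line at infinity to the disjoint line.
  let A : (Fin 3 → ℝ) →ₗ[ℝ] (Fin 3 → ℝ) := Fintype.linearCombination ℝ ![u₁, u₂, v]
  have hA : ∀ y, A y = y 0 • u₁ + y 1 • u₂ + y 2 • v := by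
    intro y
    simp [A, Fintype.linearCombination_apply, Fin.sum_univ_three]
  have hAinj : Function.Injective A := by
    rw [← LinearMap.ker_eq_bot, LinearMap.ker_eq_bot']
    intro y hy
    rw [hA] at hy
    have h1 : (y 0, y 1) = 0 := by
      by_contra hcon
      refine hu _ _ hcon ?_
      rw [eq_neg_of_add_eq_zero_left hy, ← neg_smul, h.isHomogeneous.eval_smul, hv, mul_zero]
    obtain ⟨h2, h3⟩ := Prod.mk_eq_zero.1 h1
    rw [h2, h3, zero_smul, zero_smul, zero_add, zero_add, smul_eq_zero, or_iff_left hv0] at hy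
    ext i
    fin_cases i <;> assumption
  let e : (Fin 3 → ℝ) ≃ₗ[ℝ] (Fin 3 → ℝ) := LinearEquiv.ofInjectiveEndo A hAinj
  have he : ∀ y, e y = y 0 • u₁ + y 1 • u₂ + y 2 • v := hA
  have hinf : ∀ w : ℝ × ℝ, w ≠ 0 → eval (e ![w.1, w.2, 0]) X.form ≠ 0 := by
    intro w hw
    rw [he]
    simpa using hu w.1 w.2 hw
  have hzero : ∃ q : ℝ × ℝ, eval (e ![q.1, q.2, 1]) X.form = 0 := ⟨0, by rw [he]; simpa using hv⟩
  have hsign : (∀ w : ℝ × ℝ, w ≠ 0 → 0 < eval (e ![w.1, w.2, 0]) X.form) ∨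
      ∀ w : ℝ × ℝ, w ≠ 0 → 0 < eval (e ![w.1, w.2, 0]) (-X.form) := by
    have hconn : IsPreconnected ({0}ᶜ : Set (ℝ × ℝ)) := by
      refine (isConnected_compl_singleton_of_one_lt_rank ?_ 0).isPreconnected
      rw [← Module.finrank_eq_rank]
      simp
    have hc : Continuous fun w : ℝ × ℝ => eval (e ![w.1, w.2, 0]) X.form := by
      refine continuous_eval_comp _
        ((LinearMap.continuous_of_finiteDimensional e.toLinearMap).comp ?_)
      fun_prop
    by_contra! hcon
    obtain ⟨⟨a, ha0, ha⟩, b, hb0, hb⟩ := hcon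
    rw [map_neg, neg_nonpos] at hb
    obtain ⟨c, hc0, hc⟩ := hconn.intermediate_value ha0 hb0 hc.continuousOn ⟨ha, hb⟩
    exact hinf c hc0 hc
  obtain ⟨γ, hγ, hγi, hγf, hγr⟩ : ∃ γ : Circle → ℝ × ℝ, Continuous γ ∧ Function.Injective γ ∧
      frontier (convexHull ℝ (Set.range γ)) = Set.range γ ∧
      Set.range γ = {q : ℝ × ℝ | eval (e ![q.1, q.2, 1]) X.form = 0} := by
    rcases hsign with hs | hs
    · exact h.exists_parametrization hs hzero
    · simpa using h.neg.exists_parametrization hs (by simpa using hzero)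
  refine ⟨e, γ, hγ, hγi, hγf, ?_⟩
  rw [hγr, Set.image_image]
  ext p
  induction p using Projectivization.ind with | h x hx =>
  rw [X.mk_mem_realPoints hx]
  constructor
  · intro hFx
    set y := e.symm x with hy
    have hxy : x = e y := by rw [hy, e.apply_symm_apply]
    have hy2 : y 2 ≠ 0 := by
      intro h0
      have hy' : y = ![y 0, y 1, 0] := by
        ext i
        fin_cases i <;> simp [h0]
      refine hinf (y 0, y 1) ?_ ?_
      · intro h1
        obtain ⟨h2, h3⟩ := Prod.mk_eq_zero.1 h1
        apply hx
        rw [hxy, hy', h2, h3]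
        simp
      · dsimp only
        rwa [← hy', ← hxy]
    have hyx : e ![(y 2)⁻¹ * y 0, (y 2)⁻¹ * y 1, 1] = (y 2)⁻¹ • x := by
      rw [hxy, ← map_smul]
      congr 1
      ext i
      fin_cases i <;> simp [hy2]
    refine ⟨((y 2)⁻¹ * y 0, (y 2)⁻¹ * y 1), ?_, ?_⟩
    · rw [Set.mem_ofPred, hyx, X.isHomogeneous.eval_smul, hFx, mul_zero]
    · exact (Projectivization.mk_eq_mk_iff' ℝ _ _ (chart_ne_zero e _) hx).2 ⟨(y 2)⁻¹, hyx.symm⟩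
  · rintro ⟨q, hq, hqx⟩
    beta_reduce at hqx
    rw [map_affinePoint, Projectivization.mk_eq_mk_iff'] at hqx
    obtain ⟨c, hc'⟩ := hqx
    have h1 : c ^ X.degree * eval x X.form = 0 := by
      rw [← X.isHomogeneous.eval_smul, hc']
      exact hq
    refine (mul_eq_zero.1 h1).resolve_left (pow_ne_zero _ ?_)
    rintro rfl
    exact chart_ne_zero e q (by rw [← hc', zero_smul])

/-! ### Lines meeting a convex oval -/

theorem affinePoint_injective : Function.Injective affinePoint := by
  intro q q' h
  obtain ⟨c, hc⟩ := (Projectivization.mk_eq_mk_iff' ℝ _ _ _ _).1 h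
  have h0 := congrFun hc 0
  have h1 := congrFun hc 1
  have h2 := congrFun hc 2
  simp at h0 h1 h2
  subst h2
  rw [one_mul] at h0 h1
  exact Prod.ext h0.symm h1.symm

theorem chart_cross_ne_zero (e : (Fin 3 → ℝ) ≃ₗ[ℝ] (Fin 3 → ℝ)) (q : ℝ × ℝ) {w : ℝ × ℝ}
    (hw : w ≠ 0) : e ![q.1, q.2, 1] ⨯₃ e ![w.1, w.2, 0] ≠ 0 := by
  rw [crossProduct_ne_zero_iff_linearIndependent, LinearIndependent.pair_iff]
  intro s t h
  rw [← map_smul, ← map_smul, ← map_add, LinearEquiv.map_eq_zero_iff] at h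
  have h0 := congrFun h 0
  have h1 := congrFun h 1
  have h2 := congrFun h 2
  simp at h0 h1 h2
  subst h2
  refine ⟨rfl, ?_⟩
  by_contra ht
  simp only [zero_mul, zero_add, mul_eq_zero, or_iff_right ht] at h0 h1
  exact hw (Prod.ext h0 h1)

theorem Convex.preimage_line {E : Type*} [AddCommGroup E] [Module ℝ E] {K : Set E}
    (hK : Convex ℝ K) (q w : E) : Convex ℝ {t : ℝ | q + t • w ∈ K} := by
  intro x hx y hy a b ha hb hab
  have h := hK hx hy ha hb hab
  have : q + (a • x + b • y) • w = a • (q + x • w) + b • (q + y • w) := by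
    calc _ = (1 : ℝ) • q + (a • x + b • y) • w := by rw [one_smul]
      _ = _ := by rw [← hab]; module
  rwa [← this] at h

theorem exists_mem_frontier_ray {K : Set (ℝ × ℝ)} (hK : Bornology.IsBounded K) {q w : ℝ × ℝ}
    (hq : q ∈ interior K) (hw : w ≠ 0) : ∃ t : ℝ, 0 < t ∧ q + t • w ∈ frontier K := by
  obtain ⟨ρ, hρ⟩ := hK.exists_norm_le
  have hw' : 0 < ‖w‖ := norm_pos_iff.2 hw
  set T := (|ρ| + ‖q‖ + 1) / ‖w‖ with hT
  have hT0 : 0 < T := by positivity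
  have hout : q + T • w ∉ K := by
    intro hmem
    have h1 := hρ _ hmem
    have h2 := norm_sub_le (q + T • w) q
    rw [add_sub_cancel_left, norm_smul, Real.norm_of_nonneg hT0.le, hT,
      div_mul_cancel₀ _ hw'.ne'] at h2
    linarith [le_abs_self ρ]
  have hconn : IsPreconnected ((fun t : ℝ => q + t • w) '' Set.Icc 0 T) :=
    isPreconnected_Icc.image _ (by fun_prop)
  obtain ⟨t, ht, htf⟩ : ∃ t ∈ Set.Icc 0 T, q + t • w ∈ frontier K := by
    by_contra! h
    have hsub : (fun t : ℝ => q + t • w) '' Set.Icc 0 T ⊆ interior K := by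
      refine hconn.subset_left_of_subset_union (v := (closure K)ᶜ) isOpen_interior
        isClosed_closure.isOpen_compl
        (Set.disjoint_compl_right_iff_subset.2 (interior_subset.trans subset_closure)) ?_ ?_
      · rintro _ ⟨t, ht, rfl⟩
        by_contra hcon
        rw [Set.mem_union, not_or, Set.mem_compl_iff, not_not] at hcon
        exact h t ht ⟨hcon.2, hcon.1⟩
      · exact ⟨q, ⟨0, Set.left_mem_Icc.2 hT0.le, by simp⟩, hq⟩
    exact hout (interior_subset (hsub ⟨T, Set.right_mem_Icc.2 hT0.le, rfl⟩))
  refine ⟨t, lt_of_le_of_ne ht.1 ?_, htf⟩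
  rintro rfl
  refine Set.disjoint_left.1 disjoint_interior_frontier hq ?_
  simpa using htf

namespace RealPlaneCurve

variable {X : RealPlaneCurve} {e : (Fin 3 → ℝ) ≃ₗ[ℝ] (Fin 3 → ℝ)} {C : Set (ℝ × ℝ)}

theorem mem_iff_of_realPoints_eq
    (hS : X.realPoints = Projectivization.map e.toLinearMap e.injective '' (affinePoint '' C))
    (q : ℝ × ℝ) : q ∈ C ↔ eval (e ![q.1, q.2, 1]) X.form = 0 := by
  rw [← X.mk_mem_realPoints (chart_ne_zero e q), ← map_affinePoint, hS,
    (Projectivization.map_injective e.toLinearMap e.injective).mem_set_image,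
    affinePoint_injective.mem_set_image]

theorem exists_notMem_of_realPoints_eq
    (hS : X.realPoints = Projectivization.map e.toLinearMap e.injective '' (affinePoint '' C))
    (q : ℝ × ℝ) {w : ℝ × ℝ} (hw : w ≠ 0) {a b : ℝ} (hab : a < b) :
    ∃ x, a < x ∧ x < b ∧ q + x • w ∉ C := by
  obtain ⟨x, hax, hxb, hx⟩ := exists_eval_ne_zero_of_restrictLine_ne_zero
    (restrictLine_ne_zero (X := X) (chart_cross_ne_zero e q hw)) hab
  refine ⟨x, hax, hxb, fun h => hx ?_⟩
  rwa [mem_iff_of_realPoints_eq hS, chart_add_smul] at h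

/-- If the curve is the boundary of a convex set, no three of its points are collinear: on a line
through three of them there are points off the curve on both sides of the middle one; these are
interior to the convex set, hence so is the middle point. -/
theorem not_three_collinear
    (hS : X.realPoints = Projectivization.map e.toLinearMap e.injective '' (affinePoint '' C))
    (hC : frontier (convexHull ℝ C) = C) (q : ℝ × ℝ) {w : ℝ × ℝ} (hw : w ≠ 0) {t₁ t₂ t₃ : ℝ}
    (h₁₂ : t₁ < t₂) (h₂₃ : t₂ < t₃) (h₁ : q + t₁ • w ∈ C) (h₂ : q + t₂ • w ∈ C)
    (h₃ : q + t₃ • w ∈ C) : False := by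
  obtain ⟨a, ha, ha', haC⟩ := exists_notMem_of_realPoints_eq hS q hw h₁₂
  obtain ⟨b, hb, hb', hbC⟩ := exists_notMem_of_realPoints_eq hS q hw h₂₃
  have hK := convex_convexHull ℝ C
  have hord := (hK.preimage_line q w).ordConnected
  have h1 : t₁ ∈ {t : ℝ | q + t • w ∈ convexHull ℝ C} := subset_convexHull ℝ C h₁
  have h3 : t₃ ∈ {t : ℝ | q + t • w ∈ convexHull ℝ C} := subset_convexHull ℝ C h₃
  have hint : ∀ t, t₁ ≤ t → t ≤ t₃ → q + t • w ∉ C → q + t • w ∈ interior (convexHull ℝ C) := by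
    intro t ht ht' htC
    rw [← self_sdiff_frontier, hC]
    exact ⟨hord.out h1 h3 ⟨ht, ht'⟩, htC⟩
  have hord' := (hK.interior.preimage_line q w).ordConnected
  have h2 : t₂ ∈ {t : ℝ | q + t • w ∈ interior (convexHull ℝ C)} :=
    hord'.out (hint a ha.le (by linarith) haC) (hint b (by linarith) hb'.le hbC) ⟨ha'.le, hb.le⟩
  exact Set.disjoint_left.1 disjoint_interior_frontier h2 (by rwa [hC])

theorem dotProduct_chart (a : Fin 3 → ℝ) (y : Fin 3 → ℝ) :
    a ⬝ᵥ e y = y 0 * (a ⬝ᵥ e ![1, 0, 0]) + y 1 * (a ⬝ᵥ e ![0, 1, 0])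
      + y 2 * (a ⬝ᵥ e ![0, 0, 1]) := by
  have : y = y 0 • ![1, 0, 0] + y 1 • ![0, 1, 0] + y 2 • ![0, 0, 1] := by
    ext i
    fin_cases i <;> simp
  conv_lhs => rw [this]
  simp only [map_add, map_smul, dotProduct_add, dotProduct_smul, smul_eq_mul]

theorem eq_zero_of_dotProduct_chart {a : Fin 3 → ℝ} (h : ∀ y, a ⬝ᵥ e y = 0) : a = 0 := by
  have := h (e.symm a)
  rwa [e.apply_symm_apply, dotProduct_self_eq_zero] at this

theorem le_two_of_mem_possibleNumbers
    (hS : X.realPoints = Projectivization.map e.toLinearMap e.injective '' (affinePoint '' C))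
    (hC : frontier (convexHull ℝ C) = C) {n : ℕ} (hn : n ∈ X.possibleNumbers) : n ≤ 2 := by
  obtain ⟨a, ha, -, hcard⟩ := hn
  by_contra! hlt
  have hfin := Set.finite_of_encard_eq_coe hcard
  rw [← hfin.cast_ncard_eq, ENat.natCast_inj] at hcard
  rw [← hcard, Set.two_lt_ncard_iff hfin] at hlt
  obtain ⟨p₁, p₂, p₃, hp₁, hp₂, hp₃, h₁₂, h₁₃, h₂₃⟩ := hlt
  have haff : ∀ p ∈ realToComplex ⁻¹' (X.points ∩ projLine (complexifyVec a)),
      ∃ q ∈ C, Projectivization.map e.toLinearMap e.injective (affinePoint q) = p ∧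
        q.1 * (a ⬝ᵥ e ![1, 0, 0]) + q.2 * (a ⬝ᵥ e ![0, 1, 0]) + a ⬝ᵥ e ![0, 0, 1] = 0 := by
    rintro p ⟨hp, hpa⟩
    have hp' : p ∈ X.realPoints := hp
    rw [hS] at hp'
    obtain ⟨_, ⟨q, hq, rfl⟩, rfl⟩ := hp'
    refine ⟨q, hq, rfl, ?_⟩
    rw [map_affinePoint, mk_mem_realLine, dotProduct_chart] at hpa
    simpa using hpa
  obtain ⟨q₁, hq₁, rfl, hl₁⟩ := haff p₁ hp₁
  obtain ⟨q₂, hq₂, rfl, hl₂⟩ := haff p₂ hp₂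
  obtain ⟨q₃, hq₃, rfl, hl₃⟩ := haff p₃ hp₃
  set α := a ⬝ᵥ e ![1, 0, 0] with hα
  set β := a ⬝ᵥ e ![0, 1, 0] with hβ
  set c := a ⬝ᵥ e ![0, 0, 1] with hc
  have hαβ : α ^ 2 + β ^ 2 ≠ 0 := by
    intro h0
    have hα0 : α = 0 := by nlinarith [sq_nonneg α, sq_nonneg β]
    have hβ0 : β = 0 := by nlinarith [sq_nonneg α, sq_nonneg β]
    have hc0 : c = 0 := by rw [hα0, hβ0] at hl₁; simpa using hl₁
    refine ha (eq_zero_of_dotProduct_chart (e := e) fun y => ?_)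
    rw [dotProduct_chart, ← hα, ← hβ, ← hc, hα0, hβ0, hc0]
    simp
  -- The line has direction `(-β, α)`.
  have hw : ((-β, α) : ℝ × ℝ) ≠ 0 := by
    intro h0
    obtain ⟨h1, h2⟩ := Prod.mk_eq_zero.1 h0
    rw [neg_eq_zero] at h1
    exact hαβ (by rw [h1, h2]; ring)
  obtain ⟨q₀, hl₀⟩ : ∃ q₀ : ℝ × ℝ, q₀.1 * α + q₀.2 * β + c = 0 := ⟨q₁, hl₁⟩
  have hparam : ∀ q : ℝ × ℝ, q.1 * α + q.2 * β + c = 0 →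
      ∃ t : ℝ, q₀ + t • ((-β, α) : ℝ × ℝ) = q := by
    intro q hq
    refine ⟨(-(q.1 - q₀.1) * β + (q.2 - q₀.2) * α) / (α ^ 2 + β ^ 2), Prod.ext ?_ ?_⟩
    · simp only [Prod.fst_add, Prod.smul_fst, smul_eq_mul]
      field_simp
      linear_combination α * hl₀ - α * hq
    · simp only [Prod.snd_add, Prod.smul_snd, smul_eq_mul]
      field_simp
      linear_combination β * hl₀ - β * hq
  obtain ⟨t₁, rfl⟩ := hparam q₁ hl₁
  obtain ⟨t₂, rfl⟩ := hparam q₂ hl₂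
  obtain ⟨t₃, rfl⟩ := hparam q₃ hl₃
  have n₁₂ : t₁ ≠ t₂ := by rintro rfl; exact h₁₂ rfl
  have n₁₃ : t₁ ≠ t₃ := by rintro rfl; exact h₁₃ rfl
  have n₂₃ : t₂ ≠ t₃ := by rintro rfl; exact h₂₃ rfl
  have key : ∀ {x y z : ℝ}, x < y → y < z → q₀ + x • ((-β, α) : ℝ × ℝ) ∈ C →
      q₀ + y • ((-β, α) : ℝ × ℝ) ∈ C → q₀ + z • ((-β, α) : ℝ × ℝ) ∈ C → False :=
    fun hxy hyz h1 h2 h3 => not_three_collinear hS hC q₀ hw hxy hyz h1 h2 h3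
  rcases lt_or_gt_of_ne n₁₂ with h | h <;> rcases lt_or_gt_of_ne n₁₃ with h' | h' <;>
    rcases lt_or_gt_of_ne n₂₃ with h'' | h''
  · exact key h h'' hq₁ hq₂ hq₃
  · exact key h' h'' hq₁ hq₃ hq₂
  · exact absurd (h.trans h'') h'.not_gt
  · exact key h' h hq₃ hq₁ hq₂
  · exact key h h' hq₂ hq₁ hq₃
  · exact absurd (h''.trans h) h'.not_gt
  · exact key h'' h' hq₂ hq₃ hq₁
  · exact key h'' h hq₃ hq₂ hq₁

/-- A general line through an interior point of the oval is transverse and meets the oval on both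
sides of that point. -/
theorem two_mem_possibleNumbers
    (hS : X.realPoints = Projectivization.map e.toLinearMap e.injective '' (affinePoint '' C))
    (hC : frontier (convexHull ℝ C) = C) (hb : Bornology.IsBounded C) (hnt : C.Nontrivial) :
    2 ∈ X.possibleNumbers := by
  have hint : (interior (convexHull ℝ C)).Nonempty := by
    rw [Set.nonempty_iff_ne_empty]
    intro h0
    -- Otherwise the convex hull is contained in the curve, which contains no segment.
    have hsub : convexHull ℝ C ⊆ C := by
      rw [← self_sdiff_frontier, hC, Set.sdiff_eq_empty] at h0
      exact h0
    obtain ⟨x, hx, y, hy, hxy⟩ := hnt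
    obtain ⟨t, ht0, ht1, ht⟩ := exists_notMem_of_realPoints_eq hS x
      (sub_ne_zero.2 hxy.symm) (zero_lt_one' ℝ)
    exact ht (hsub ((convex_convexHull ℝ C).add_smul_sub_mem (subset_convexHull ℝ C hx)
      (subset_convexHull ℝ C hy) ⟨ht0.le, ht1.le⟩))
  obtain ⟨q, hq⟩ := hint
  have hqF : eval (e ![q.1, q.2, 1]) X.form ≠ 0 := by
    rw [Ne, ← mem_iff_of_realPoints_eq hS, ← hC]
    exact Set.disjoint_left.1 disjoint_interior_frontier hq
  obtain ⟨u, -, hu, htr⟩ := exists_transverse hqF isOpen_univ Set.univ_nonempty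
  set a := u ⨯₃ e ![q.1, q.2, 1] with ha
  set S := realToComplex ⁻¹' (X.points ∩ projLine (complexifyVec a)) with hSdef
  have hSn : S.encard = ({t : ℝ | eval (u + t • e ![q.1, q.2, 1]) X.form = 0}.ncard : ℕ∞) := by
    rw [(finite_roots hu).cast_ncard_eq]
    exact encard_inter_cross hu hqF
  have hmem := (⟨a, hu, htr, hSn⟩ : _ ∈ X.possibleNumbers)
  have hle := le_two_of_mem_possibleNumbers hS hC hmem
  have haq : a ⬝ᵥ e ![q.1, q.2, 1] = 0 := by
    rw [dotProduct_comm, ha, dot_cross_self]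
  obtain ⟨w, hw, haw⟩ : ∃ w : ℝ × ℝ, w ≠ 0 ∧ a ⬝ᵥ e ![w.1, w.2, 0] = 0 := by
    by_cases h0 : a ⬝ᵥ e ![1, 0, 0] = 0
    · exact ⟨(1, 0), by simp, h0⟩
    · refine ⟨(-(a ⬝ᵥ e ![0, 1, 0]), a ⬝ᵥ e ![1, 0, 0]), fun h1 => h0 (Prod.mk_eq_zero.1 h1).2, ?_⟩
      rw [dotProduct_chart]
      simp
      ring
  have hbK := (isBounded_convexHull (s := C)).2 hb
  obtain ⟨s, hs, hsC⟩ := exists_mem_frontier_ray hbK hq hw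
  obtain ⟨t, ht, htC⟩ := exists_mem_frontier_ray hbK hq (neg_ne_zero.2 hw)
  rw [hC] at hsC htC
  rw [smul_neg, ← neg_smul] at htC
  have hpt : ∀ x : ℝ, q + x • w ∈ C →
      Projectivization.map e.toLinearMap e.injective (affinePoint (q + x • w)) ∈ S := by
    intro x hx
    refine ⟨?_, ?_⟩
    · change _ ∈ X.realPoints
      rw [hS]
      exact ⟨_, ⟨_, hx, rfl⟩, rfl⟩
    · rw [map_affinePoint, mk_mem_realLine, chart_add_smul, dotProduct_add, dotProduct_smul, haq,
        haw]
      simp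
  have hge : 1 < S.encard := by
    refine Set.one_lt_encard_iff.2 ⟨_, _, hpt s hsC, hpt (-t) htC, fun heq => ?_⟩
    have h1 := affinePoint_injective
      (Projectivization.map_injective e.toLinearMap e.injective heq)
    have h2 : (s + t) • w = 0 := by
      have h3 : (s + t) • w = (q + s • w) - (q + -t • w) := by module
      rw [h3, h1, sub_self]
    rcases smul_eq_zero.1 h2 with h3 | h3
    · linarith
    · exact hw h3
  rw [hSn] at hge
  have hge' := Nat.one_lt_cast.1 hge
  have h2 := le_antisymm hle hge'
  rwa [h2] at hmem

end RealPlaneCurve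

theorem mainTheorem6 (X : RealPlaneCurve) (hX : X.IsSmooth)
    (hreal : ∃ p : RealPlane, X.IsSmoothAt (realToComplex p)) :
    IsGreatest X.possibleNumbers 2 ↔ IsConvexOval X.realPoints := by
  constructor
  · rintro ⟨-, hub⟩
    obtain ⟨p, hp⟩ := hreal
    exact RealPlaneCurve.isConvexOval_of_bounded hX ⟨p, hp.1⟩ fun n hn => hub hn
  · rintro ⟨e, γ, hγ, hγi, hγf, hS⟩
    refine ⟨RealPlaneCurve.two_mem_possibleNumbers hS hγf (isCompact_range hγ).isBounded ?_,
      fun n hn => RealPlaneCurve.le_two_of_mem_possibleNumbers hS hγf hn⟩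
    exact ⟨γ 1, ⟨1, rfl⟩, γ (-1), ⟨-1, rfl⟩, hγi.ne (by
      intro h
      have := congrArg (fun c : Circle => (c : ℂ)) h
      norm_num at this)⟩
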